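/- Let $X$ be a complex manifold (Hausdorff, with a countable basis, of pure finite dimension). For open sets $U'\subset U$ of $X$ let $H^{p,q}_{\bar\vartheta}(U,U')$ be the relative Dolbeault cohomology of $(U,U')$, i.e. the $q$-th cohomology of the complex with terms $\mathscr E^{(p,q)}(U)\oplus\mathscr E^{(p,q-1)}(U')$ (where $\mathscr E^{(p,q)}$ is the sheaf of $C^\infty$ $(p,q)$-forms and $\mathscr E^{(p,-1)}=0$) and differential $\bar\vartheta(\xi_1,\xi_{01})=(\bar\partial\xi_1,\ \xi_1|_{U'}-\bar\partial\xi_{01})$. Let $\mathscr O^{(p)}$ be the sheaf of holomorphic $p$-forms, and let $H^q(U,U';\mathscr O^{(p)})$ be its relative cohomology, computed by any flabby resolution $\mathscr F^\bullet$ of $\mathscr O^{(p)}$ by sheaves of complex vector spaces on $X$ as the $q$-th cohomology of the complex of sections of $\mathscr F^\bullet$ over $U$ that vanish on $U'$. Let $S$ be a closed set in $X$, let $V\supset S$ be an open set in $X$, and let $p,q\ge 0$. Then: 1. Restriction of forms, $(\xi_1,\xi_{01})\mapsto(\xi_1|_V,\ \xi_{01}|_{V\smallsetminus S})$, induces an isomorphism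 of complex vector spaces $$H^{p,q}_{\bar\vartheta}(X,X\smallsetminus S)\overset{\sim}{\longrightarrow}H^{p,q}_{\bar\vartheta}(V,V\smallsetminus S).$$ 2. This isomorphism is compatible with excision for relative sheaf cohomology: restriction of sections induces an isomorphism $H^q(X,X\smallsetminus S;\mathscr O^{(p)})\overset{\sim}{\to}H^q(V,V\smallsetminus S;\mathscr O^{(p)})$, and classes $a\in H^{p,q}_{\bar\vartheta}(X,X\smallsetminus S)$ and $b\in H^q(X,X\smallsetminus S;\mathscr O^{(p)})$ correspond to each other under the canonical correspondence between relative Dolbeault and relative sheaf cohomology if and only if their restrictions to $(V,V\smallsetminus S)$ do. Here, for a pair $(U,U')$, the classes $a$ and $b$ are said to correspond if there are a flabby resolution $\mathscr G^\bullet$ of $\mathscr O^{(p)}$ on $X$ and morphisms of complexes of sheaves $\mathscr E^{(p,\bullet)}\to\mathscr G^\bullet\leftarrow\mathscr F^\bullet$ which are the identity on $\mathscr O^{(p)}$, such that $a$ and $b$ have the same image in the cohomology of the complex $\mathscr G^{q}(U)\oplus\mathscr G^{q-1}(U')$ with differential $(\sigma,\tau)\mapsto(d\sigma,\ \sigma|_{U'}-d\tau)$,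 the class of a section $\sigma$ of $\mathscr F^q$ over $U$ vanishing on $U'$ being mapped to the class of $(g(\sigma),0)$, where $g$ is the morphism $\mathscr F^\bullet\to\mathscr G^\bullet$. (This is the graph of the relative Dolbeault isomorphism $H^{p,q}_{\bar\vartheta}(U,U')\simeq H^q(U,U';\mathscr O^{(p)})$.) -/

import Mathlib

open scoped Manifold ContDiff Topology
open CategoryTheory TopologicalSpace

universe u
noncomputable section
set_option linter.unusedSectionVars false
namespace RelDolbeault
section Linear
variable {E : Type} [NormedAddCommGroup E] [NormedSpace ℂ E]

/-- Complex-valued real-multilinear alternating `k`-forms on a complex vector space `E`, i.e.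
`Λ^k (E_ℝ)^* ⊗ ℂ`. -/
abbrev CForm (E : Type) [NormedAddCommGroup E] [NormedSpace ℂ E] (k : ℕ) : Type :=
  E [⋀^Fin k]→L[ℝ] ℂ

/-- The form `η` is of type `(p, q)`. A complex-valued real-multilinear alternating `k`-form is a sum
of components of types `(a, b)`, `a + b = k`, and multiplying all arguments by `c ∈ ℂ` multiplies the
component of type `(a, b)` by `c ^ a * conj c ^ b`; for `k = p + q` the condition therefore says that
only the component of type `(p, q)` is present. -/
def IsOfType (p q : ℕ) {k : ℕ} (η : CForm E k) : Prop :=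
  ∀ (c : ℂ) (v : Fin k → E),
    η (fun i => c • v i) = c ^ p * (starRingEnd ℂ c) ^ q * η v

/-- Multiplication by `i` on `E`. -/
def mulI (E : Type) [NormedAddCommGroup E] [NormedSpace ℂ E] : E →L[ℝ] E :=
  (Complex.I • ContinuousLinearMap.id ℂ E).restrictScalars ℝ

@[simp] theorem mulI_apply (v : E) : mulI E v = Complex.I • v := rfl

/-- The conjugate-linear part `v ↦ (L v + i L (i v)) / 2` of a real-linear map `L`, as a
continuous linear function of `L`. -/
def antiPart (F : Type) [NormedAddCommGroup F] [NormedSpace ℝ F]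
    [NormedSpace ℂ F] [IsScalarTower ℝ ℂ F] :
    (E →L[ℝ] F) →L[ℝ] (E →L[ℝ] F) :=
  (1 / 2 : ℂ) • (ContinuousLinearMap.id ℝ (E →L[ℝ] F) +
    Complex.I • ContinuousLinearMap.precomp F (mulI E))

theorem antiPart_apply {F : Type} [NormedAddCommGroup F] [NormedSpace ℝ F]
    [NormedSpace ℂ F] [IsScalarTower ℝ ℂ F]
    (L : E →L[ℝ] F) (v : E) :
    antiPart F L v = (1 / 2 : ℂ) • (L v + Complex.I • L (Complex.I • v)) := rfl

/-- antilinear -/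
theorem antiPart_smul {F : Type} [NormedAddCommGroup F] [NormedSpace ℝ F]
    [NormedSpace ℂ F] [IsScalarTower ℝ ℂ F]
    (L : E →L[ℝ] F) (c : ℂ) (v : E) :
    antiPart F L (c • v) = (starRingEnd ℂ c) • antiPart F L v := by
  obtain ⟨a, b⟩ := c
  have h : (⟨a, b⟩ : ℂ) = (a : ℂ) + b * Complex.I := Complex.mk_eq_add_mul_I a b
  have key : ∀ (r : ℝ) (w : E), L ((r : ℂ) • w) = (r : ℂ) • L w := by
    intro r w
    have := L.map_smul r w
    rw [Complex.coe_smul, this, ← algebraMap_smul ℂ r (L w)]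
    rfl
  rw [h]
  have e1 : ((a : ℂ) + b * Complex.I) • v = (a : ℂ) • v + (b : ℂ) • (Complex.I • v) := by
    module
  have e2 : Complex.I • (((a : ℂ) + b * Complex.I) • v)
      = (a : ℂ) • (Complex.I • v) - (b : ℂ) • v := by
    rw [smul_smul, mul_add, mul_left_comm, Complex.I_mul_I]
    module
  rw [antiPart_apply, antiPart_apply, e2, e1, map_add, map_sub, key, key, key, key]
  simp only [map_add, map_mul, Complex.conj_ofReal, Complex.conj_I]
  have hI : Complex.I * Complex.I = -1 := Complex.I_mul_I
  have e3 : ∀ w : F, Complex.I • Complex.I • w = -w := by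
    intro w
    rw [smul_smul, hI, neg_one_smul]
  have e4 : ((a : ℂ) + b * -Complex.I) • (1 / 2 : ℂ) • (L v + Complex.I • L (Complex.I • v))
      = (1 / 2 : ℂ) • ((a : ℂ) • L v + (a : ℂ) • Complex.I • L (Complex.I • v)
        - (b : ℂ) • Complex.I • L v - (b : ℂ) • Complex.I • Complex.I • L (Complex.I • v)) := by
    module
  rw [e4, e3]
  module

/-- `antiPart` is complex-linear in the map. -/
theorem antiPart_const_smul {F : Type} [NormedAddCommGroup F] [NormedSpace ℝ F]
    [NormedSpace ℂ F] [IsScalarTower ℝ ℂ F]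
    (c : ℂ) (L : E →L[ℝ] F) : antiPart F (c • L) = c • antiPart F L := by
  ext v
  simp only [antiPart_apply, smul_apply]
  module

/-- The operator `∂̄` on forms on an open set of the vector space `E`: the alternatization of the
conjugate-linear part of the derivative, i.e. `∂̄α = ∑ⱼ dz̄ⱼ ∧ ∂α/∂z̄ⱼ` in linear coordinates `zⱼ`. -/
def dbarE {k : ℕ} (α : E → CForm E k) (x : E) : CForm E (k + 1) :=
  ContinuousAlternatingMap.alternatizeUncurryFin (antiPart (CForm E k) (fderiv ℝ α x))

/-- The symbol of `∂̄`, as a continuous linear map. -/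
def dbarCLM (E : Type) [NormedAddCommGroup E] [NormedSpace ℂ E] (k : ℕ) :
    (E →L[ℝ] CForm E k) →L[ℝ] CForm E (k + 1) :=
  (ContinuousAlternatingMap.alternatizeUncurryFinCLM ℝ E ℂ).comp (antiPart (CForm E k))

theorem dbarE_eq {k : ℕ} (α : E → CForm E k) : dbarE α = fun x => dbarCLM E k (fderiv ℝ α x) := rfl

theorem dbarE_congr {k : ℕ} {α β : E → CForm E k} {x : E} (h : α =ᶠ[𝓝 x] β) :
    dbarE α x = dbarE β x := by
  rw [dbarE, dbarE, h.fderiv_eq]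

theorem dbarE_add {k : ℕ} {α β : E → CForm E k} {x : E} (hα : DifferentiableAt ℝ α x)
    (hβ : DifferentiableAt ℝ β x) : dbarE (α + β) x = dbarE α x + dbarE β x := by
  simp only [dbarE_eq]
  rw [fderiv_add hα hβ, map_add]

theorem dbarE_smul {k : ℕ} (c : ℂ) {α : E → CForm E k} {x : E} (hα : DifferentiableAt ℝ α x) :
    dbarE (c • α) x = c • dbarE α x := by
  rw [dbarE, dbarE, fderiv_const_smul hα c, antiPart_const_smul,
    ContinuousAlternatingMap.alternatizeUncurryFin_smul]

/-- `∂̄` maps forms of type `(p, q)` to forms of type `(p, q + 1)`. -/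
theorem dbarE_type {k p q : ℕ} {α : E → CForm E k} {x : E} (hα : DifferentiableAt ℝ α x)
    (ht : ∀ᶠ y in 𝓝 x, IsOfType p q (α y)) : IsOfType p (q + 1) (dbarE α x) := by
  have hD : ∀ w, IsOfType p q (fderiv ℝ α x w) := by
    intro w c v
    have h1 : HasFDerivAt (fun y => α y (fun i => c • v i)) 
        ((ContinuousAlternatingMap.apply ℝ E ℂ (fun i => c • v i)).comp (fderiv ℝ α x)) x :=
      (ContinuousAlternatingMap.apply ℝ E ℂ (fun i => c • v i)).hasFDerivAt.comp x hα.hasFDerivAt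
    have h2 : HasFDerivAt (fun y => (c ^ p * (starRingEnd ℂ c) ^ q) • α y v) 
        ((c ^ p * (starRingEnd ℂ c) ^ q) •
          (ContinuousAlternatingMap.apply ℝ E ℂ v).comp (fderiv ℝ α x)) x :=
      HasFDerivAt.fun_const_smul (f := fun y => α y v)
        ((ContinuousAlternatingMap.apply ℝ E ℂ v).hasFDerivAt.comp x hα.hasFDerivAt) _
    have h3 := h2.congr_of_eventuallyEq (f₁ := fun y => α y (fun i => c • v i))
      (ht.mono fun y hy => hy c v)
    exact congrArg (fun T => T w) (h1.unique h3)
  intro c v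
  rw [dbarE, ContinuousAlternatingMap.alternatizeUncurryFin_apply,
    ContinuousAlternatingMap.alternatizeUncurryFin_apply, Finset.mul_sum]
  refine Finset.sum_congr rfl fun i _ => ?_
  rw [antiPart_smul]
  have : i.removeNth (fun j => c • v j) = fun j => c • i.removeNth v j := rfl
  have h4 : antiPart (CForm E k) (fderiv ℝ α x) (v i) (fun j => c • i.removeNth v j)
    = c ^ p * (starRingEnd ℂ c) ^ q * antiPart (CForm E k) (fderiv ℝ α x) (v i) (i.removeNth v) := by
    simp only [antiPart_apply, ContinuousAlternatingMap.smul_apply,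
      ContinuousAlternatingMap.add_apply, smul_eq_mul]
    rw [hD, hD]; ring
  rw [this, ContinuousAlternatingMap.smul_apply, h4]
  simp only [smul_eq_mul, zsmul_eq_mul]
  ring

theorem dbarE_contDiffOn {k : ℕ} {α : E → CForm E k} {s : Set E} (hs : IsOpen s)
    (hα : ContDiffOn ℝ ∞ α s) : ContDiffOn ℝ ∞ (dbarE α) s := by
  rw [dbarE_eq]
  exact (dbarCLM E k).contDiff.comp_contDiffOn (hα.fderiv_of_isOpen hs (m := ∞) (by exact le_rfl))

theorem fderiv_clm_comp_aux {A B C : Type} [NormedAddCommGroup A] [NormedSpace ℝ A]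
    [NormedAddCommGroup B] [NormedSpace ℝ B] [NormedAddCommGroup C] [NormedSpace ℝ C]
    (T : B →L[ℝ] C) {f : A → B} {x : A} (hf : DifferentiableAt ℝ f x) :
    fderiv ℝ (fun y => T (f y)) x = T.comp (fderiv ℝ f x) :=
  (T.hasFDerivAt.comp x hf.hasFDerivAt).fderiv

theorem dbarE_dbarE {k : ℕ} {α : E → CForm E k} {x : E} (hα : ContDiffAt ℝ 2 α x) :
    dbarE (dbarE α) x = 0 := by
  have hd : DifferentiableAt ℝ (fderiv ℝ α) x :=
    (hα.fderiv_right (m := 1) (by norm_num)).differentiableAt one_ne_zero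
  have hs : IsSymmSndFDerivAt ℝ α x := hα.isSymmSndFDerivAt (by simp)
  have h1 : fderiv ℝ (dbarE α) x = (dbarCLM E k).comp (fderiv ℝ (fderiv ℝ α) x) := by
    rw [dbarE_eq]
    exact fderiv_clm_comp_aux (A := E) (B := E →L[ℝ] CForm E k) (C := CForm E (k + 1))
      (dbarCLM E k) (f := fderiv ℝ α) hd
  set B := fderiv ℝ (fderiv ℝ α) x with hB
  have h2 : antiPart (CForm E (k + 1)) ((dbarCLM E k).comp B) =
      (ContinuousAlternatingMap.alternatizeUncurryFinCLM ℝ E ℂ).comp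
        ((antiPart (CForm E k)).comp (antiPart (E →L[ℝ] CForm E k) B)) := by
    ext1 v
    simp only [antiPart_apply, dbarCLM, ContinuousLinearMap.comp_apply, map_add,
      antiPart_const_smul,
      ContinuousAlternatingMap.alternatizeUncurryFinCLM_apply,
      ContinuousAlternatingMap.alternatizeUncurryFin_smul,
      ContinuousAlternatingMap.alternatizeUncurryFin_add]
  rw [dbarE, h1, h2]
  apply ContinuousAlternatingMap.alternatizeUncurryFin_alternatizeUncurryFinCLM_comp_of_symmetric
  intro v w
  have e := fun a b => hs.eq a b
  simp only [ContinuousLinearMap.comp_apply, antiPart_apply, smul_apply,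
    add_apply, ← hB] at e ⊢
  rw [e w v, e w (Complex.I • v), e (Complex.I • w) v, e (Complex.I • w) (Complex.I • v)]
  module

/-- `∂̄` commutes with pullback by holomorphic maps. -/
theorem dbarE_pullback {k : ℕ} {α : E → CForm E k} {f : E → E} {x : E}
    (hα : DifferentiableAt ℝ α (f x)) (hf : ContDiffAt ℂ 2 f x) :
    dbarE (fun y => (α (f y)).compContinuousLinearMap ((fderiv ℂ f y).restrictScalars ℝ)) x =
      (dbarE α (f x)).compContinuousLinearMap ((fderiv ℂ f x).restrictScalars ℝ) := by
  have hf1 : DifferentiableAt ℂ f x := hf.differentiableAt (by simp)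
  have hg : DifferentiableAt ℂ (fderiv ℂ f) x :=
    (hf.fderiv_right (m := 1) (by norm_num)).differentiableAt one_ne_zero
  have hs : IsSymmSndFDerivAt ℂ f x := hf.isSymmSndFDerivAt (by simp)
  let R : (E →L[ℂ] E) →L[ℝ] (E →L[ℝ] E) := ContinuousLinearMap.restrictScalarsL ℂ E E ℝ ℝ
  have h1 : HasFDerivAt (fun y => (fderiv ℂ f y).restrictScalars ℝ)
      (R.comp ((fderiv ℂ (fderiv ℂ f) x).restrictScalars ℝ)) x :=
    R.hasFDerivAt.comp x (hg.hasFDerivAt.restrictScalars ℝ)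
  have h2 : HasFDerivAt (fun y => α (f y))
      ((fderiv ℝ α (f x)).comp ((fderiv ℂ f x).restrictScalars ℝ)) x :=
    hα.hasFDerivAt.comp x (hf1.hasFDerivAt.restrictScalars ℝ)
  have h3 := (h2.continuousAlternatingMapCompContinuousLinearMap h1).fderiv
  rw [dbarE, h3, map_add, ContinuousAlternatingMap.alternatizeUncurryFin_add]
  set Q := (α (f x)).fderivCompContinuousLinearMap ((fderiv ℂ f x).restrictScalars ℝ) with hQ
  have z : ContinuousAlternatingMap.alternatizeUncurryFin (antiPart (CForm E k)
      (Q.comp (R.comp ((fderiv ℂ (fderiv ℂ f) x).restrictScalars ℝ)))) = 0 := by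
    have e : antiPart (CForm E k) (Q.comp (R.comp ((fderiv ℂ (fderiv ℂ f) x).restrictScalars ℝ)))
        = (1 / 2 : ℂ) • (Q.comp (R.comp ((fderiv ℂ (fderiv ℂ f) x).restrictScalars ℝ)) +
          Complex.I • Q.comp
            ((R.comp ((fderiv ℂ (fderiv ℂ f) x).restrictScalars ℝ)).comp (mulI E))) := rfl
    rw [e, ContinuousAlternatingMap.alternatizeUncurryFin_smul,
      ContinuousAlternatingMap.alternatizeUncurryFin_add,
      ContinuousAlternatingMap.alternatizeUncurryFin_smul, hQ,
      ContinuousAlternatingMap.alternatizeUncurryFin_fderivCompContinuousLinearMap_eq_zero,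
      ContinuousAlternatingMap.alternatizeUncurryFin_fderivCompContinuousLinearMap_eq_zero]
    · simp
    · intro v w
      change fderiv ℂ (fderiv ℂ f) x (Complex.I • v) w = fderiv ℂ (fderiv ℂ f) x (Complex.I • w) v
      rw [map_smul, map_smul, smul_apply, smul_apply, hs.eq v w]
    · intro v w
      exact hs.eq v w
  rw [z, add_zero]
  ext v
  simp only [dbarE, ContinuousAlternatingMap.alternatizeUncurryFin_apply,
    ContinuousAlternatingMap.compContinuousLinearMap_apply, antiPart_apply,
    ContinuousLinearMap.comp_apply]
  refine Finset.sum_congr rfl fun i _ => ?_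
  congr 1
  simp only [
    ContinuousAlternatingMap.smul_apply, ContinuousAlternatingMap.add_apply]
  have : (fderiv ℂ f x).restrictScalars ℝ (Complex.I • v i)
    = Complex.I • (fderiv ℂ f x).restrictScalars ℝ (v i) := (fderiv ℂ f x).map_smul _ _
  rw [this]
  rfl

end Linear

section Manifold
variable {E : Type} [NormedAddCommGroup E] [NormedSpace ℂ E]
variable {X : Type u} [TopologicalSpace X] [ChartedSpace E X] [IsManifold 𝓘(ℂ, E) ω X]

/-- Not necessarily continuous complex-valued `k`-forms on an open set `U` of a manifold `X` modelled
on `E`. The tangent space of `X` at a point `x` is `E` by definition (via the preferred chart at `x`). -/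
abbrev RoughForm (E : Type) [NormedAddCommGroup E] [NormedSpace ℂ E] {X : Type u}
    [TopologicalSpace X] (U : Opens X) (k : ℕ) : Type u :=
  U → CForm E k

open Classical in
/-- Extension by zero, of no significance outside `U`. -/
def extZero {U : Opens X} {k : ℕ} (α : RoughForm E U k) (x : X) : CForm E k :=
  if h : x ∈ U then α ⟨x, h⟩ else 0

/-- The image of `U` in the preferred chart at `x₀`. -/
def chartDom (E : Type) [NormedAddCommGroup E] [NormedSpace ℂ E] {X : Type u}
    [TopologicalSpace X] [ChartedSpace E X] (x₀ : X) (U : Opens X) : Set E :=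
  (extChartAt 𝓘(ℂ, E) x₀).target ∩ (extChartAt 𝓘(ℂ, E) x₀).symm ⁻¹' (U : Set X)

/-- The expression of the form `α` in the preferred chart at `x₀`, i.e. its pullback by the inverse of
this chart (meaningful on `chartDom E x₀ U`). Since the tangent space at a point `x` is identified
with `E` by the preferred chart at `x`, the derivative of the inverse of the chart at `x₀` is the
tangent coordinate change from `x₀` to `x`. -/
def chartRep {U : Opens X} {k : ℕ} (x₀ : X) (α : RoughForm E U k) (y : E) : CForm E k :=
  (extZero α ((extChartAt 𝓘(ℂ, E) x₀).symm y)).compContinuousLinearMap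
    ((tangentCoordChange 𝓘(ℂ, E) x₀ ((extChartAt 𝓘(ℂ, E) x₀).symm y)
      ((extChartAt 𝓘(ℂ, E) x₀).symm y)).restrictScalars ℝ)

theorem isOpen_chartDom (x₀ : X) (U : Opens X) : IsOpen (chartDom E x₀ U) :=
  (continuousOn_extChartAt_symm x₀).isOpen_inter_preimage (isOpen_extChartAt_target x₀) U.isOpen

theorem mem_chartDom {U : Opens X} {x x₀ : X} (hx : x ∈ U)
    (h : x ∈ (extChartAt 𝓘(ℂ, E) x₀).source) :
    extChartAt 𝓘(ℂ, E) x₀ x ∈ chartDom E x₀ U := by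
  refine ⟨(extChartAt 𝓘(ℂ, E) x₀).map_source h, ?_⟩
  rw [Set.mem_preimage, (extChartAt 𝓘(ℂ, E) x₀).left_inv h]
  exact hx

theorem extZero_of_mem {U : Opens X} {k : ℕ} (α : RoughForm E U k) {x : X} (h : x ∈ U) :
    extZero α x = α ⟨x, h⟩ := dif_pos h

theorem extZero_add {U : Opens X} {k : ℕ} (α β : RoughForm E U k) (x : X) :
    extZero (α + β) x = extZero α x + extZero β x := by
  unfold extZero; split_ifs <;> simp

theorem extZero_smul {U : Opens X} {k : ℕ} (c : ℂ) (α : RoughForm E U k) (x : X) :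
    extZero (c • α) x = c • extZero α x := by
  unfold extZero
  split_ifs
  · rfl
  · ext v
    exact (mul_zero c).symm

theorem chartRep_add {U : Opens X} {k : ℕ} (x₀ : X) (α β : RoughForm E U k) :
    chartRep x₀ (α + β) = chartRep x₀ α + chartRep x₀ β := by
  funext y; ext v; simp [chartRep, extZero_add]

theorem chartRep_smul {U : Opens X} {k : ℕ} (x₀ : X) (c : ℂ) (α : RoughForm E U k) :
    chartRep x₀ (c • α) = c • chartRep x₀ α := by
  funext y; ext v; simp [chartRep, extZero_smul]

theorem chartRep_zero {U : Opens X} {k : ℕ} (x₀ : X) :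
    chartRep x₀ (0 : RoughForm E U k) = 0 := by
  funext y
  ext v
  simp only [chartRep]
  have h0 : extZero (0 : RoughForm E U k) ((extChartAt 𝓘(ℂ, E) x₀).symm y) = 0 := by
    unfold extZero
    split_ifs <;> rfl
  rw [h0]
  rfl

/-- Restriction of forms to a smaller open set. -/
def restr {U V : Opens X} (h : V ≤ U) {k : ℕ} (α : RoughForm E U k) : RoughForm E V k :=
  fun x => α ⟨x, h x.2⟩

theorem chartRep_restr {U V : Opens X} (h : V ≤ U) {k : ℕ} (x₀ : X) (α : RoughForm E U k) :
    Set.EqOn (chartRep x₀ (restr h α)) (chartRep x₀ α) (chartDom E x₀ V) := by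
  intro y hy
  have hy2 : (extChartAt 𝓘(ℂ, E) x₀).symm y ∈ V := hy.2
  simp only [chartRep, extZero_of_mem _ hy2, extZero_of_mem _ (h hy2), restr]

theorem chartDom_mono {U V : Opens X} (h : V ≤ U) (x₀ : X) :
    chartDom E x₀ V ⊆ chartDom E x₀ U := fun _ hy => ⟨hy.1, h hy.2⟩

theorem chartRep_type {U : Opens X} {p q k : ℕ} {α : RoughForm E U k}
    (hα : ∀ x, IsOfType p q (α x)) (x₀ : X) (y : E) : IsOfType p q (chartRep x₀ α y) := by
  intro c v
  by_cases hy : (extChartAt 𝓘(ℂ, E) x₀).symm y ∈ U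
  · simp only [chartRep, extZero_of_mem _ hy,
      ContinuousAlternatingMap.compContinuousLinearMap_apply]
    rw [← hα]
    congr 1
    funext i
    exact (tangentCoordChange 𝓘(ℂ, E) x₀ _ _).map_smul c (v i)
  · have h0 : extZero α ((extChartAt 𝓘(ℂ, E) x₀).symm y) = 0 := dif_neg hy
    simp only [chartRep, h0, ContinuousAlternatingMap.compContinuousLinearMap_apply]
    exact (mul_zero _).symm

/-- Change of charts. -/
theorem chartRep_change {U : Opens X} {k : ℕ} (α : RoughForm E U k) (x₀ x : X) {y : E}
    (hy : y ∈ (extChartAt 𝓘(ℂ, E) x₀).target)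
    (hx : (extChartAt 𝓘(ℂ, E) x₀).symm y ∈ (extChartAt 𝓘(ℂ, E) x).source) :
    chartRep x₀ α y =
      (chartRep x α ((extChartAt 𝓘(ℂ, E) x ∘ (extChartAt 𝓘(ℂ, E) x₀).symm) y)
        ).compContinuousLinearMap
        ((fderiv ℂ (extChartAt 𝓘(ℂ, E) x ∘ (extChartAt 𝓘(ℂ, E) x₀).symm) y).restrictScalars ℝ) := by
  have hs := (extChartAt 𝓘(ℂ, E) x₀).map_target hy
  have hD : fderiv ℂ (extChartAt 𝓘(ℂ, E) x ∘ (extChartAt 𝓘(ℂ, E) x₀).symm) y =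
      tangentCoordChange 𝓘(ℂ, E) x₀ x ((extChartAt 𝓘(ℂ, E) x₀).symm y) := by
    have := hasFDerivWithinAt_tangentCoordChange (I := 𝓘(ℂ, E)) (x := x₀) (y := x) ⟨hs, hx⟩
    rw [(extChartAt 𝓘(ℂ, E) x₀).right_inv hy] at this
    simp only [modelWithCornersSelf_coe, Set.range_id, hasFDerivWithinAt_univ] at this
    exact this.fderiv
  rw [hD]
  ext v
  simp only [chartRep, Function.comp_apply, (extChartAt 𝓘(ℂ, E) x).left_inv hx,
    ContinuousAlternatingMap.compContinuousLinearMap_apply]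
  congr 1
  funext i
  exact (tangentCoordChange_comp (I := 𝓘(ℂ, E)) ⟨⟨hs, hx⟩, mem_extChartAt_source _⟩).symm

theorem contDiffAt_change (x₀ x : X) {y : E}
    (hy : y ∈ (extChartAt 𝓘(ℂ, E) x₀).target)
    (hx : (extChartAt 𝓘(ℂ, E) x₀).symm y ∈ (extChartAt 𝓘(ℂ, E) x).source) :
    ContDiffAt ℂ ω (extChartAt 𝓘(ℂ, E) x ∘ (extChartAt 𝓘(ℂ, E) x₀).symm) y := by
  have h := contDiffWithinAt_ext_coord_change (I := 𝓘(ℂ, E)) (n := ω) x x₀ (y := y) (by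
    rw [PartialEquiv.trans_source, PartialEquiv.symm_source]
    exact ⟨hy, hx⟩)
  rwa [modelWithCornersSelf_coe, Set.range_id, contDiffWithinAt_univ] at h

/-- A form is smooth if its expressions in all charts are `C^∞`. -/
def IsSmoothForm {U : Opens X} {k : ℕ} (α : RoughForm E U k) : Prop :=
  ∀ x₀ : X, ContDiffOn ℝ ∞ (chartRep x₀ α) (chartDom E x₀ U)

/-- The operator `∂̄` on forms on `U ⊆ X`, computed at `x` in the preferred chart at `x`. -/
def dbarRough {U : Opens X} {k : ℕ} (α : RoughForm E U k) : RoughForm E U (k + 1) :=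
  fun x => dbarE (chartRep (x : X) α) (extChartAt 𝓘(ℂ, E) (x : X) x)

/-- `∂̄` may be computed in any chart. -/
theorem chartRep_dbar {U : Opens X} {k : ℕ} {α : RoughForm E U k} (hα : IsSmoothForm α) (x₀ : X) :
    Set.EqOn (chartRep x₀ (dbarRough α)) (dbarE (chartRep x₀ α)) (chartDom E x₀ U) := by
  intro y hy
  have hyU : (extChartAt 𝓘(ℂ, E) x₀).symm y ∈ U := hy.2
  set x := (extChartAt 𝓘(ℂ, E) x₀).symm y with hx
  have hxs : x ∈ (extChartAt 𝓘(ℂ, E) x).source := mem_extChartAt_source x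
  set τ := extChartAt 𝓘(ℂ, E) x ∘ (extChartAt 𝓘(ℂ, E) x₀).symm with hτ
  have hτy : τ y = extChartAt 𝓘(ℂ, E) x x := rfl
  have hev : chartRep x₀ α =ᶠ[𝓝 y] fun z => (chartRep x α (τ z)).compContinuousLinearMap
      ((fderiv ℂ τ z).restrictScalars ℝ) := by
    have ht : ∀ᶠ z in 𝓝 y, z ∈ (extChartAt 𝓘(ℂ, E) x₀).target :=
      (isOpen_extChartAt_target x₀).mem_nhds hy.1
    have hc : ContinuousAt (extChartAt 𝓘(ℂ, E) x₀).symm y :=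
      (continuousOn_extChartAt_symm x₀).continuousAt ((isOpen_extChartAt_target x₀).mem_nhds hy.1)
    have hz : ∀ᶠ z in 𝓝 y, (extChartAt 𝓘(ℂ, E) x₀).symm z ∈ (extChartAt 𝓘(ℂ, E) x).source :=
      hc.eventually ((isOpen_extChartAt_source x).mem_nhds hxs)
    filter_upwards [ht, hz] with z h1 h2
    exact chartRep_change α x₀ x h1 h2
  have hmem : τ y ∈ chartDom E x U := mem_chartDom hyU hxs
  have hd : DifferentiableAt ℝ (chartRep x α) (τ y) :=
    ((hα x).contDiffAt ((isOpen_chartDom x U).mem_nhds hmem)).differentiableAt (by simp)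
  have hf : ContDiffAt ℂ ω τ y := contDiffAt_change x₀ x hy.1 hxs
  rw [dbarE_congr hev, dbarE_pullback hd (hf.of_le le_top), 
    chartRep_change (dbarRough α) x₀ x hy.1 hxs]
  congr 1
  ext v
  have hyU' : (extChartAt 𝓘(ℂ, E) x).symm (extChartAt 𝓘(ℂ, E) x x) ∈ U := by
    rwa [(extChartAt 𝓘(ℂ, E) x).left_inv hxs]
  have e : chartRep x (dbarRough α) (τ y) = dbarRough α ⟨x, hyU⟩ := by
    ext w
    simp only [chartRep, hτy, (extChartAt 𝓘(ℂ, E) x).left_inv hxs, extZero_of_mem _ hyU,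
      ContinuousAlternatingMap.compContinuousLinearMap_apply]
    congr 1
    funext i
    exact tangentCoordChange_self (I := 𝓘(ℂ, E)) hxs
  have e' : chartRep x (dbarRough α) (τ y) v = dbarE (chartRep x α) (τ y) v := by
    rw [e, hτy]
    rfl
  exact e'

end Manifold
section Sheaves

/-- Sheaves of complex vector spaces on `X`. -/
abbrev VSheaf (X : Type u) [TopologicalSpace X] : Type (u + 1) :=
  Sheaf (Opens.grothendieckTopology X) (ModuleCat.{u} ℂ)

/-- A local linear condition on `k`-forms on open sets of `X`. It defines a sheaf of `k`-forms. -/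
structure FormCondition (E : Type) [NormedAddCommGroup E] [NormedSpace ℂ E] (X : Type u)
    [TopologicalSpace X] (k : ℕ) where
  sub : ∀ U : Opens X, Submodule ℂ (RoughForm E U k)
  restr_mem : ∀ {U V : Opens X} (h : V ≤ U) {α : RoughForm E U k}, α ∈ sub U → restr h α ∈ sub V
  local_mem : ∀ {U : Opens X} {α : RoughForm E U k},
    (∀ x ∈ U, ∃ (V : Opens X) (h : V ≤ U), x ∈ V ∧ restr h α ∈ sub V) → α ∈ sub U

variable {E : Type} [NormedAddCommGroup E] [NormedSpace ℂ E]
variable {X : Type u} [TopologicalSpace X]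

/-- Restriction of forms satisfying the condition. -/
def FormCondition.restrLin {k : ℕ} (P : FormCondition E X k) {U V : Opens X} (h : V ≤ U) :
    P.sub U →ₗ[ℂ] P.sub V where
  toFun α := ⟨restr h α.1, P.restr_mem h α.2⟩
  map_add' _ _ := rfl
  map_smul' _ _ := rfl

/-- The presheaf of forms satisfying the condition. -/
def FormCondition.presheaf {k : ℕ} (P : FormCondition E X k) :
    TopCat.Presheaf (ModuleCat.{u} ℂ) (TopCat.of X) where
  obj U := ModuleCat.of ℂ (P.sub U.unop)
  map i := ModuleCat.ofHom (P.restrLin (leOfHom i.unop))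
  map_id _ := rfl
  map_comp _ _ := rfl

theorem FormCondition.isSheaf {k : ℕ} (P : FormCondition E X k) : P.presheaf.IsSheaf := by
  refine (TopCat.Presheaf.isSheaf_iff_isSheafUniqueGluing P.presheaf).2 fun ι U sf hsf => ?_
  have hmem : ∀ x : (iSup U : Opens X), ∃ i, (x : X) ∈ U i := fun x => Opens.mem_iSup.1 x.2
  choose j hj using hmem
  have agree : ∀ (i i' : ι) (x : X) (h : x ∈ U i) (h' : x ∈ U i'),
      (sf i).1 ⟨x, h⟩ = (sf i').1 ⟨x, h'⟩ := by
    intro i i' x h h'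
    have e := congrArg Subtype.val (hsf i i')
    exact congrFun e ⟨x, ⟨h, h'⟩⟩
  let g : RoughForm E (iSup U : Opens X) k := fun x => (sf (j x)).1 ⟨x, hj x⟩
  have hg : ∀ i, restr (le_iSup U i) g = (sf i).1 := by
    intro i
    funext x
    exact agree _ _ _ _ _
  have hgm : g ∈ P.sub (iSup U) := P.local_mem fun x hx => by
    obtain ⟨i, hi⟩ := Opens.mem_iSup.1 hx
    exact ⟨U i, le_iSup U i, hi, by rw [hg i]; exact (sf i).2⟩
  refine ⟨⟨g, hgm⟩, fun i => Subtype.ext (hg i), fun t ht => ?_⟩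
  refine Subtype.ext (funext fun x => ?_)
  obtain ⟨i, hi⟩ := Opens.mem_iSup.1 x.2
  have e := congrFun (congrArg Subtype.val (ht i)) ⟨x, hi⟩
  have e' := congrFun (hg i) ⟨x, hi⟩
  exact e.trans e'.symm

/-- The sheaf of forms satisfying the condition. -/
def FormCondition.sheaf {k : ℕ} (P : FormCondition E X k) : VSheaf X := ⟨P.presheaf, P.isSheaf⟩

/-- A morphism of sheaves of forms from a family of linear maps commuting with restrictions. -/
def FormCondition.hom {k l : ℕ} (P : FormCondition E X k) (Q : FormCondition E X l)
    (f : ∀ U, P.sub U →ₗ[ℂ] Q.sub U)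
    (hf : ∀ {U V : Opens X} (h : V ≤ U) (α : P.sub U),
      f V (P.restrLin h α) = Q.restrLin h (f U α)) : P.sheaf ⟶ Q.sheaf :=
  ⟨{ app := fun U => ModuleCat.ofHom (f U.unop)
     naturality := by
      intro U V i
      ext α
      exact hf (leOfHom i.unop) α }⟩

variable [ChartedSpace E X] [IsManifold 𝓘(ℂ, E) ω X]

variable (E X) in
/-- The sheaf `E^{p,q}` of `C^∞` forms of type `(p, q)` on the complex manifold `X`. -/
def smoothForms (p q : ℕ) : FormCondition E X (p + q) where
  sub U :=
    { carrier := {α | (∀ x, IsOfType p q (α x)) ∧ IsSmoothForm α}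
      add_mem' := by
        rintro α β ⟨h1, h2⟩ ⟨h3, h4⟩
        refine ⟨fun x c v => ?_, fun x₀ => ?_⟩
        · change α x _ + β x _ = _ * (α x v + β x v)
          rw [h1, h3, mul_add]
        · rw [chartRep_add]
          exact (h2 x₀).add (h4 x₀)
      zero_mem' := by
        refine ⟨fun x c v => (mul_zero _).symm, fun x₀ => ?_⟩
        rw [chartRep_zero]
        exact contDiffOn_const
      smul_mem' := by
        rintro c α ⟨h1, h2⟩
        refine ⟨fun x c' v => ?_, fun x₀ => ?_⟩
        · change c * α x _ = _ * (c * α x v)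
          rw [h1, mul_left_comm]
        · rw [chartRep_smul]
          exact (h2 x₀).const_smul c }
  restr_mem h α hα := ⟨fun x => hα.1 _, fun x₀ =>
    ((hα.2 x₀).mono (chartDom_mono h x₀)).congr (chartRep_restr h x₀ α)⟩
  local_mem := by
    intro U α H
    refine ⟨fun x => ?_, fun x₀ y hy => ?_⟩
    · obtain ⟨V, h, hx, hV⟩ := H x x.2
      exact hV.1 ⟨x, hx⟩
    · obtain ⟨V, h, hx, hV⟩ := H _ hy.2
      have hyV : y ∈ chartDom E x₀ V := ⟨hy.1, hx⟩
      have hn := (isOpen_chartDom x₀ V).mem_nhds hyV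
      have h1 := (hV.2 x₀).contDiffAt hn
      exact (h1.congr_of_eventuallyEq
        ((chartRep_restr h x₀ α).symm.eventuallyEq_of_mem hn)).contDiffWithinAt

variable (E X) in
/-- The sheaf `O^{(p)}` of holomorphic `p`-forms: forms of type `(p, 0)` whose expressions in all
charts are holomorphic. -/
def holomorphicForms (p : ℕ) : FormCondition E X p where
  sub U :=
    { carrier := {α | (∀ x, IsOfType p 0 (α x)) ∧
        ∀ x₀ : X, AnalyticOnNhd ℂ (chartRep x₀ α) (chartDom E x₀ U)}
      add_mem' := by
        rintro α β ⟨h1, h2⟩ ⟨h3, h4⟩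
        refine ⟨fun x c v => ?_, fun x₀ => ?_⟩
        · change α x _ + β x _ = _ * (α x v + β x v)
          rw [h1, h3, mul_add]
        · rw [chartRep_add]
          exact (h2 x₀).add (h4 x₀)
      zero_mem' := by
        refine ⟨fun x c v => (mul_zero _).symm, fun x₀ => ?_⟩
        rw [chartRep_zero]
        exact analyticOnNhd_const
      smul_mem' := by
        rintro c α ⟨h1, h2⟩
        refine ⟨fun x c' v => ?_, fun x₀ => ?_⟩
        · change c * α x _ = _ * (c * α x v)
          rw [h1, mul_left_comm]
        · rw [chartRep_smul]
          exact fun y hy => (h2 x₀ y hy).const_smul }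
  restr_mem h α hα := ⟨fun x => hα.1 _, fun x₀ =>
    ((hα.2 x₀).mono (chartDom_mono h x₀)).congr (isOpen_chartDom x₀ _)
      (chartRep_restr h x₀ α).symm⟩
  local_mem := by
    intro U α H
    refine ⟨fun x => ?_, fun x₀ y hy => ?_⟩
    · obtain ⟨V, h, hx, hV⟩ := H x x.2
      exact hV.1 ⟨x, hx⟩
    · obtain ⟨V, h, hx, hV⟩ := H _ hy.2
      have hyV : y ∈ chartDom E x₀ V := ⟨hy.1, hx⟩
      have hn := (isOpen_chartDom x₀ V).mem_nhds hyV
      exact (hV.2 x₀ y hyV).congr ((chartRep_restr h x₀ α).eventuallyEq_of_mem hn)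

theorem smoothForms_differentiableAt {k : ℕ} {U : Opens X} {α : RoughForm E U k}
    (hα : IsSmoothForm α) {x₀ : X} {y : E} (hy : y ∈ chartDom E x₀ U) :
    DifferentiableAt ℝ (chartRep x₀ α) y :=
  ((hα x₀).contDiffAt ((isOpen_chartDom x₀ U).mem_nhds hy)).differentiableAt (by simp)

/-- `∂̄ : E^{p,q}(U) → E^{p,q+1}(U)`. -/
def dbarLin (p q : ℕ) (U : Opens X) :
    (smoothForms E X p q).sub U →ₗ[ℂ] (smoothForms E X p (q + 1)).sub U where
  toFun α := ⟨dbarRough α.1, fun x => dbarE_type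
      (smoothForms_differentiableAt α.2.2 (mem_chartDom x.2 (mem_extChartAt_source _)))
      (Filter.Eventually.of_forall fun y => chartRep_type α.2.1 _ y), fun x₀ =>
      (dbarE_contDiffOn (isOpen_chartDom x₀ U) (α.2.2 x₀)).congr (chartRep_dbar α.2.2 x₀)⟩
  map_add' α β := by
    refine Subtype.ext (funext fun x => ?_)
    have hx := mem_chartDom x.2 (mem_extChartAt_source (I := 𝓘(ℂ, E)) (x : X))
    change dbarE (chartRep (x : X) (α.1 + β.1)) _ = dbarE _ _ + dbarE _ _
    rw [chartRep_add]
    exact dbarE_add (smoothForms_differentiableAt α.2.2 hx)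
      (smoothForms_differentiableAt β.2.2 hx)
  map_smul' c α := by
    refine Subtype.ext (funext fun x => ?_)
    have hx := mem_chartDom x.2 (mem_extChartAt_source (I := 𝓘(ℂ, E)) (x : X))
    change dbarE (chartRep (x : X) (c • α.1)) _ = c • dbarE _ _
    rw [chartRep_smul]
    exact dbarE_smul c (smoothForms_differentiableAt α.2.2 hx)

theorem dbarLin_dbarLin (p q : ℕ) (U : Opens X) (α : (smoothForms E X p q).sub U) :
    dbarLin p (q + 1) U (dbarLin p q U α) = 0 := by
  refine Subtype.ext (funext fun x => ?_)
  have hx := mem_chartDom x.2 (mem_extChartAt_source (I := 𝓘(ℂ, E)) (x : X))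
  have hn := (isOpen_chartDom (x : X) U).mem_nhds hx
  change dbarE (chartRep (x : X) (dbarRough α.1)) _ = 0
  rw [dbarE_congr ((chartRep_dbar α.2.2 (x : X)).eventuallyEq_of_mem hn)]
  exact dbarE_dbarE (((α.2.2 (x : X)).contDiffAt hn).of_le (by norm_cast))

variable (E X) in
/-- `∂̄ : E^{p,q} → E^{p,q+1}` as a morphism of sheaves. -/
def dbarSheaf (p q : ℕ) : (smoothForms E X p q).sheaf ⟶ (smoothForms E X p (q + 1)).sheaf :=
  FormCondition.hom _ _ (dbarLin p q) fun {_ V} h α => by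
    refine Subtype.ext (funext fun x => ?_)
    have hx := mem_chartDom x.2 (mem_extChartAt_source (I := 𝓘(ℂ, E)) (x : X))
    have hn := (isOpen_chartDom (x : X) V).mem_nhds hx
    exact dbarE_congr ((chartRep_restr h (x : X) α.1).eventuallyEq_of_mem hn)

variable (E X) in
/-- The inclusion `O^{(p)} → E^{p,0}`. -/
def holInclusion (p : ℕ) : (holomorphicForms E X p).sheaf ⟶ (smoothForms E X p 0).sheaf :=
  FormCondition.hom _ _ (fun U => Submodule.inclusion
    (p := (holomorphicForms E X p).sub U) (p' := (smoothForms E X p 0).sub U) fun _ hα =>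
      ⟨hα.1, fun x₀ y hy => ((hα.2 x₀ y hy).contDiffAt.restrict_scalars ℝ).contDiffWithinAt⟩)
    fun _ _ => rfl

variable (E X) in
/-- The Dolbeault complex of sheaves `E^{p,0} → E^{p,1} → ⋯` with differential `∂̄`. -/
def dolbeaultComplex (p : ℕ) : CochainComplex (VSheaf X) ℕ :=
  CochainComplex.of (fun q => (smoothForms E X p q).sheaf) (dbarSheaf E X p) fun q => by
    ext U α
    exact dbarLin_dbarLin p q U.unop α

end Sheaves

section Cones

/-- The terms `A^q ⊕ B^{q-1}` of the co-mapping cone of a morphism `φ : A → B` of complexes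
(with `B^{-1} = 0`). -/
def coneX {A B : CochainComplex (ModuleCat.{u} ℂ) ℕ} (_φ : A ⟶ B) : ℕ → ModuleCat.{u} ℂ
  | 0 => A.X 0
  | q + 1 => ModuleCat.of ℂ (A.X (q + 1) × B.X q)

/-- The differential `(a, b) ↦ (d a, φ a - d b)` of the co-mapping cone. -/
def coneD {A B : CochainComplex (ModuleCat.{u} ℂ) ℕ} (φ : A ⟶ B) :
    ∀ q : ℕ, coneX φ q ⟶ coneX φ (q + 1)
  | 0 => ModuleCat.ofHom (LinearMap.prod (A.d 0 1).hom (φ.f 0).hom)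
  | q + 1 => ModuleCat.ofHom (LinearMap.prod
      ((A.d (q + 1) (q + 2)).hom ∘ₗ LinearMap.fst ℂ (A.X (q + 1)) (B.X q))
      ((φ.f (q + 1)).hom ∘ₗ LinearMap.fst ℂ (A.X (q + 1)) (B.X q)
        - (B.d q (q + 1)).hom ∘ₗ LinearMap.snd ℂ (A.X (q + 1)) (B.X q)))

theorem d_d_apply (A : CochainComplex (ModuleCat.{u} ℂ) ℕ) (i j k : ℕ) (a : A.X i) :
    (A.d j k).hom ((A.d i j).hom a) = 0 :=
  congrArg (fun f => f.hom a) (A.d_comp_d i j k)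

theorem map_d_apply {A B : CochainComplex (ModuleCat.{u} ℂ) ℕ} (φ : A ⟶ B) (i j : ℕ) (a : A.X i) :
    (φ.f j).hom ((A.d i j).hom a) = (B.d i j).hom ((φ.f i).hom a) :=
  (congrArg (fun f => f.hom a) (φ.comm i j)).symm

theorem coneD_coneD {A B : CochainComplex (ModuleCat.{u} ℂ) ℕ} (φ : A ⟶ B) (q : ℕ) :
    coneD φ q ≫ coneD φ (q + 1) = 0 := by
  cases q with
  | zero =>
    ext a
    refine Prod.ext (d_d_apply A 0 1 2 a) ?_
    exact sub_eq_zero.2 (map_d_apply φ 0 1 a)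
  | succ q =>
    ext a
    refine Prod.ext (d_d_apply A _ _ _ a.1) ?_
    change (φ.f (q + 2)).hom ((A.d (q + 1) (q + 2)).hom a.1) - (B.d (q + 1) (q + 2)).hom
      ((φ.f (q + 1)).hom a.1 - (B.d q (q + 1)).hom a.2) = 0
    rw [map_sub, d_d_apply, sub_zero, map_d_apply, sub_self]

/-- The co-mapping cone of a morphism of complexes. -/
def coCone {A B : CochainComplex (ModuleCat.{u} ℂ) ℕ} (φ : A ⟶ B) :
    CochainComplex (ModuleCat.{u} ℂ) ℕ :=
  CochainComplex.of (coneX φ) (coneD φ) (coneD_coneD φ)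

theorem coCone_d {A B : CochainComplex (ModuleCat.{u} ℂ) ℕ} (φ : A ⟶ B) (q : ℕ) :
    (coCone φ).d q (q + 1) = coneD φ q :=
  CochainComplex.of_d _ _ _

/-- The components of `coConeMap`. -/
def coneMapX {A B A' B' : CochainComplex (ModuleCat.{u} ℂ) ℕ} (φ : A ⟶ B) (φ' : A' ⟶ B')
    (a : A ⟶ A') (b : B ⟶ B') : ∀ q : ℕ, coneX φ q ⟶ coneX φ' q
  | 0 => a.f 0
  | q + 1 => ModuleCat.ofHom (LinearMap.prodMap (a.f (q + 1)).hom (b.f q).hom)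

theorem coneMapX_coneD {A B A' B' : CochainComplex (ModuleCat.{u} ℂ) ℕ} (φ : A ⟶ B) (φ' : A' ⟶ B')
    (a : A ⟶ A') (b : B ⟶ B') (w : φ ≫ b = a ≫ φ') (q : ℕ) :
    coneMapX φ φ' a b q ≫ coneD φ' q = coneD φ q ≫ coneMapX φ φ' a b (q + 1) := by
  have hw : ∀ (i : ℕ) (x : A.X i), (φ'.f i).hom ((a.f i).hom x) = (b.f i).hom ((φ.f i).hom x) :=
    fun i x => congrArg (fun f => (f.f i).hom x) w.symm
  cases q with
  | zero =>
    ext x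
    exact Prod.ext (map_d_apply a 0 1 x).symm (hw 0 x)
  | succ q =>
    ext x
    refine Prod.ext (map_d_apply a _ _ x.1).symm ?_
    change (φ'.f (q + 1)).hom ((a.f (q + 1)).hom x.1) - (B'.d q (q + 1)).hom ((b.f q).hom x.2)
      = (b.f (q + 1)).hom ((φ.f (q + 1)).hom x.1 - (B.d q (q + 1)).hom x.2)
    rw [map_sub, hw, map_d_apply]

/-- The morphism of co-mapping cones induced by a commutative square. -/
def coConeMap {A B A' B' : CochainComplex (ModuleCat.{u} ℂ) ℕ} (φ : A ⟶ B) (φ' : A' ⟶ B')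
    (a : A ⟶ A') (b : B ⟶ B') (w : φ ≫ b = a ≫ φ') : coCone φ ⟶ coCone φ' where
  f := coneMapX φ φ' a b
  comm' i j hij := by
    obtain rfl : i + 1 = j := hij
    rw [coCone_d, coCone_d]
    exact coneMapX_coneD φ φ' a b w i

/-- The kernel of a morphism of complexes. -/
def kerComplex {A B : CochainComplex (ModuleCat.{u} ℂ) ℕ} (φ : A ⟶ B) :
    CochainComplex (ModuleCat.{u} ℂ) ℕ where
  X q := ModuleCat.of ℂ (LinearMap.ker (φ.f q).hom)
  d i j := ModuleCat.ofHom ((A.d i j).hom.restrict fun x hx => by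
    rw [LinearMap.mem_ker] at hx ⊢
    rw [map_d_apply, hx, map_zero])
  shape i j h := by
    refine ModuleCat.hom_ext (LinearMap.ext fun x => Subtype.ext ?_)
    exact congrArg (fun f => f.hom x.1) (A.shape i j h)
  d_comp_d' i j k _ _ := by
    refine ModuleCat.hom_ext (LinearMap.ext fun x => Subtype.ext ?_)
    exact d_d_apply A i j k x.1

/-- The morphism of kernels induced by a commutative square. -/
def kerComplexMap {A B A' B' : CochainComplex (ModuleCat.{u} ℂ) ℕ} (φ : A ⟶ B) (φ' : A' ⟶ B')
    (a : A ⟶ A') (b : B ⟶ B') (w : φ ≫ b = a ≫ φ') : kerComplex φ ⟶ kerComplex φ' where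
  f q := ModuleCat.ofHom ((a.f q).hom.restrict fun x hx => by
    rw [LinearMap.mem_ker] at hx ⊢
    have hw : (φ'.f q).hom ((a.f q).hom x) = (b.f q).hom ((φ.f q).hom x) :=
      congrArg (fun f => (f.f q).hom x) w.symm
    rw [hw, hx, map_zero])
  comm' i j _ := by
    ext x
    exact Subtype.ext (map_d_apply a i j x.1).symm

/-- The components of `kerToCone`. -/
def kerToConeX {A B : CochainComplex (ModuleCat.{u} ℂ) ℕ} (φ : A ⟶ B) :
    ∀ q : ℕ, (kerComplex φ).X q ⟶ coneX φ q
  | 0 => ModuleCat.ofHom (LinearMap.ker (φ.f 0).hom).subtype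
  | q + 1 => ModuleCat.ofHom (LinearMap.prod (LinearMap.ker (φ.f (q + 1)).hom).subtype 0)

theorem kerToConeX_coneD {A B : CochainComplex (ModuleCat.{u} ℂ) ℕ} (φ : A ⟶ B) (q : ℕ) :
    kerToConeX φ q ≫ coneD φ q = (kerComplex φ).d q (q + 1) ≫ kerToConeX φ (q + 1) := by
  cases q with
  | zero =>
    ext x
    exact Prod.ext rfl x.2
  | succ q =>
    ext x
    refine Prod.ext rfl ?_
    change (φ.f (q + 1)).hom x.1 - (B.d q (q + 1)).hom 0 = 0
    rw [map_zero, sub_zero]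
    exact x.2

/-- The canonical morphism `a ↦ (a, 0)` from the kernel to the co-mapping cone. -/
def kerToCone {A B : CochainComplex (ModuleCat.{u} ℂ) ℕ} (φ : A ⟶ B) :
    kerComplex φ ⟶ coCone φ where
  f := kerToConeX φ
  comm' i j hij := by
    obtain rfl : i + 1 = j := hij
    rw [coCone_d]
    exact kerToConeX_coneD φ i

end Cones

section Relative
variable {X : Type u} [TopologicalSpace X]

/-- The complex of sections over `U` of a complex of sheaves. -/
abbrev sectionsOn (K : CochainComplex (VSheaf X) ℕ) (U : Opens X) :
    CochainComplex (ModuleCat.{u} ℂ) ℕ :=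
  (((sheafSections (Opens.grothendieckTopology X) (ModuleCat.{u} ℂ)).obj
    (Opposite.op U)).mapHomologicalComplex (ComplexShape.up ℕ)).obj K

/-- Restriction of sections to a smaller open set. -/
def sectionsRes (K : CochainComplex (VSheaf X) ℕ) {U V : Opens X} (h : V ≤ U) :
    sectionsOn K U ⟶ sectionsOn K V :=
  (NatTrans.mapHomologicalComplex ((sheafSections (Opens.grothendieckTopology X)
    (ModuleCat.{u} ℂ)).map (homOfLE h).op) (ComplexShape.up ℕ)).app K

/-- The map on sections over `U` induced by a morphism of complexes of sheaves. -/
def sectionsMap {K L : CochainComplex (VSheaf X) ℕ} (f : K ⟶ L) (U : Opens X) :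
    sectionsOn K U ⟶ sectionsOn L U :=
  (((sheafSections (Opens.grothendieckTopology X) (ModuleCat.{u} ℂ)).obj
    (Opposite.op U)).mapHomologicalComplex (ComplexShape.up ℕ)).map f

theorem sectionsRes_comp (K : CochainComplex (VSheaf X) ℕ) {U V W : Opens X} (h : V ≤ U)
    (h' : W ≤ V) : sectionsRes K h ≫ sectionsRes K h' = sectionsRes K (h'.trans h) := by
  ext q x
  exact (congrArg (fun f => f.hom x) ((K.X q).obj.map_comp (homOfLE h).op (homOfLE h').op)).symm

theorem sectionsRes_map {K L : CochainComplex (VSheaf X) ℕ} (f : K ⟶ L) {U V : Opens X}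
    (h : V ≤ U) : sectionsRes K h ≫ sectionsMap f V = sectionsMap f U ≫ sectionsRes L h := by
  ext q x
  exact congrArg (fun f => f.hom x) ((f.f q).hom.naturality (homOfLE h).op)

/-- A pair `(U, U')` of open sets of `X` with `U' ⊆ U`. -/
structure OpenPair (X : Type u) [TopologicalSpace X] where
  total : Opens X
  sub : Opens X
  le : sub ≤ total

/-- `(V, V') ≤ (U, U')` if `V ⊆ U` and `V' ⊆ U'`. -/
instance : LE (OpenPair X) := ⟨fun Q P => Q.total ≤ P.total ∧ Q.sub ≤ P.sub⟩

/-- Restriction to a smaller pair, on the co-mapping cones of `K(U) → K(U')`. -/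
def OpenPair.coneRes {P Q : OpenPair X} (K : CochainComplex (VSheaf X) ℕ) (h : Q ≤ P) :
    coCone (sectionsRes K P.le) ⟶ coCone (sectionsRes K Q.le) :=
  coConeMap _ _ (sectionsRes K h.1) (sectionsRes K h.2)
    (by rw [sectionsRes_comp, sectionsRes_comp])

/-- The map on the co-mapping cones of `K(U) → K(U')` induced by a morphism of complexes of sheaves. -/
def OpenPair.coneMap (P : OpenPair X) {K L : CochainComplex (VSheaf X) ℕ} (f : K ⟶ L) :
    coCone (sectionsRes K P.le) ⟶ coCone (sectionsRes L P.le) :=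
  coConeMap _ _ (sectionsMap f P.total) (sectionsMap f P.sub) (sectionsRes_map f P.le)

/-- Restriction to a smaller pair, on the complexes of sections over `U` vanishing on `U'`. -/
def OpenPair.kerRes {P Q : OpenPair X} (K : CochainComplex (VSheaf X) ℕ) (h : Q ≤ P) :
    kerComplex (sectionsRes K P.le) ⟶ kerComplex (sectionsRes K Q.le) :=
  kerComplexMap _ _ (sectionsRes K h.1) (sectionsRes K h.2)
    (by rw [sectionsRes_comp, sectionsRes_comp])

/-- A flabby resolution `0 → S → K⁰ → K¹ → ⋯` of a sheaf `S`. Exactness is that of sequences of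
sheaves, i.e. every section annihilated by a map is locally in the image of the preceding map. -/
structure FlabbyResolution (S : VSheaf X) where
  K : CochainComplex (VSheaf X) ℕ
  ε : S ⟶ K.X 0
  flabby : ∀ q : ℕ, TopCat.Presheaf.IsFlasque (X := TopCat.of X) (K.X q).obj
  ε_d : ε ≫ K.d 0 1 = 0
  ε_injective : ∀ U : Opens X, Function.Injective (ε.hom.app (Opposite.op U)).hom
  exact_zero : ∀ (U : Opens X) (s : (K.X 0).obj.obj (Opposite.op U)),
    ((K.d 0 1).hom.app (Opposite.op U)).hom s = 0 → ∀ x ∈ U, ∃ (V : Opens X) (h : V ≤ U), x ∈ V ∧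
      ∃ t : S.obj.obj (Opposite.op V), (ε.hom.app (Opposite.op V)).hom t =
        ((K.X 0).obj.map (homOfLE h).op).hom s
  exact_succ : ∀ (q : ℕ) (U : Opens X) (s : (K.X (q + 1)).obj.obj (Opposite.op U)),
    ((K.d (q + 1) (q + 2)).hom.app (Opposite.op U)).hom s = 0 →
      ∀ x ∈ U, ∃ (V : Opens X) (h : V ≤ U), x ∈ V ∧
        ∃ t : (K.X q).obj.obj (Opposite.op V), ((K.d q (q + 1)).hom.app (Opposite.op V)).hom t =
          ((K.X (q + 1)).obj.map (homOfLE h).op).hom s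

/-- The cochain complex `E^{p,•}(P)` of relative Dolbeault cochains of a pair `P = (U, U')`: in degree
`q` it consists of the pairs `(ξ₁, ξ₀₁)` in `E^{p,q}(U) ⊕ E^{p,q-1}(U')`, with differential
`(ξ₁, ξ₀₁) ↦ (∂̄ξ₁, ξ₁|_{U'} - ∂̄ξ₀₁)`. -/
def relDolbeaultComplex (E : Type) [NormedAddCommGroup E] [NormedSpace ℂ E]
    [ChartedSpace E X] [IsManifold 𝓘(ℂ, E) ω X] (p : ℕ) (P : OpenPair X) :
    CochainComplex (ModuleCat.{u} ℂ) ℕ :=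
  coCone (sectionsRes (dolbeaultComplex E X p) P.le)

/-- Relative Dolbeault cohomology `H^{p,q}_{ϑ̄}(U, U')` of a pair of open sets. -/
def relDolbeaultCohomology (E : Type) [NormedAddCommGroup E] [NormedSpace ℂ E]
    [ChartedSpace E X] [IsManifold 𝓘(ℂ, E) ω X] (p q : ℕ) (P : OpenPair X) : ModuleCat.{u} ℂ :=
  (relDolbeaultComplex E p P).homology q

/-- The map of relative Dolbeault cohomology induced by restriction of forms to a smaller pair,
`(ξ₁, ξ₀₁) ↦ (ξ₁|_V, ξ₀₁|_{V'})`. -/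
def relDolbeaultRes (E : Type) [NormedAddCommGroup E] [NormedSpace ℂ E]
    [ChartedSpace E X] [IsManifold 𝓘(ℂ, E) ω X] (p q : ℕ) {P Q : OpenPair X} (h : Q ≤ P) :
    relDolbeaultCohomology E p q P ⟶ relDolbeaultCohomology E p q Q :=
  HomologicalComplex.homologyMap (OpenPair.coneRes (dolbeaultComplex E X p) h) q

namespace FlabbyResolution
variable {S : VSheaf X}

/-- Relative cohomology `H^q(U, U'; S)` of a pair of open sets, computed by a flabby resolution
`F` of `S`: the `q`-th cohomology of the complex of sections of `F` over `U` that vanish on `U'`.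
(The restriction of `F` to the open set `U` is a flabby resolution of `S|_U`.) -/
def cohomology (R : FlabbyResolution S) (q : ℕ) (P : OpenPair X) : ModuleCat.{u} ℂ :=
  (kerComplex (sectionsRes R.K P.le)).homology q

/-- Restriction of relative sheaf cohomology to a smaller pair. -/
def res (R : FlabbyResolution S) (q : ℕ) {P Q : OpenPair X} (h : Q ≤ P) :
    R.cohomology q P ⟶ R.cohomology q Q :=
  HomologicalComplex.homologyMap (OpenPair.kerRes R.K h) q

end FlabbyResolution

/-- The canonical correspondence between relative Dolbeault cohomology and relative cohomology of
the sheaf of holomorphic `p`-forms, i.e. the graph of the relative Dolbeault isomorphism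
`H^{p,q}_{ϑ̄}(U, U') ≃ H^q(U, U'; O^{(p)})`, the right hand side being computed by the flabby
resolution `R`.

Both `E^{p,•}` and `R` are mapped to a flabby resolution `G` by morphisms of resolutions of
`O^{(p)}`, that is, morphisms of complexes of sheaves which are the identity on `O^{(p)}`. A class
`a` of relative Dolbeault cochains and a class `b` of cocycles of `R` over `U` vanishing on `U'`
correspond to each other if they have the same image in the cohomology of the co-mapping cone of
`G(U) → G(U')`, into which the complex of sections of `G` over `U` that vanish on `U'`
is mapped by `σ ↦ (σ, 0)`. -/
def RelDolbeaultCorresponds {E : Type} [NormedAddCommGroup E] [NormedSpace ℂ E]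
    [ChartedSpace E X] [IsManifold 𝓘(ℂ, E) ω X] {p : ℕ}
    (R : FlabbyResolution (holomorphicForms E X p).sheaf) {q : ℕ} {P : OpenPair X}
    (a : relDolbeaultCohomology E p q P) (b : R.cohomology q P) : Prop :=
  ∃ (G : FlabbyResolution (holomorphicForms E X p).sheaf)
    (f : dolbeaultComplex E X p ⟶ G.K) (g : R.K ⟶ G.K),
    holInclusion E X p ≫ f.f 0 = G.ε ∧ R.ε ≫ g.f 0 = G.ε ∧
      (HomologicalComplex.homologyMap (P.coneMap f) q).hom a =
        (HomologicalComplex.homologyMap (P.coneMap g) q).hom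
          ((HomologicalComplex.homologyMap (kerToCone (sectionsRes R.K P.le)) q).hom b)

/-- The pair `(U, U ∖ S)` for an open set `U` and a closed set `S`. -/
def complPair (U : Opens X) {S : Set X} (hS : IsClosed S) : OpenPair X where
  total := U
  sub := U ⊓ ⟨Sᶜ, hS.isOpen_compl⟩
  le := inf_le_left

theorem complPair_le {U V : Opens X} (h : V ≤ U) {S : Set X} (hS : IsClosed S) :
    complPair V hS ≤ complPair U hS :=
  ⟨h, inf_le_inf_right _ h⟩

end Relative
end RelDolbeault
end

open RelDolbeault

universe v

noncomputable section
namespace RelDolbeault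

/-! ### Elementwise homology of complexes of modules -/

section Homology
variable {R : Type v} [Ring R] {ι : Type*} {c : ComplexShape ι}
  {K L : HomologicalComplex (ModuleCat.{u} R) c}

/-! Put `W = X ∖ S`. Since `S ⊆ V`, the open sets `V` and `W` cover `X`, and they meet in `V ∖ S`.
The sheaf axiom for this cover says that, for every sheaf `F`, the square formed by `F(X)`, `F(V)`,
`F(W)` and `F(V ∖ S)` is cartesian. Everything rests on this Mayer–Vietoris square.

For sections vanishing on the smaller set this already suffices: a section over `V` that vanishes on
`V ∖ S` extends uniquely by zero to `X`. Restriction is thus an isomorphism of complexes even before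
cohomology is taken (`isIso_kerRes`), and this gives excision for relative sheaf cohomology.

For the co-mapping cones one needs in addition that every section over `V ∖ S` is a difference of a
section over `V` and one over `W`. Then `0 → F(X) → F(V) ⊕ F(W) → F(V ∖ S) → 0` is exact in each
degree, and restriction of cones is an isomorphism in cohomology by a diagram chase
(`isIso_homologyMap_coConeMap`). Smooth forms satisfy this by a cutoff function
(`smoothForms_exists_sub`); flabby sheaves satisfy it because restriction from `V` alone is
surjective.

For compatibility, the same `G`, `f`, `g` serve as witnesses on both pairs. All maps commute with
restriction, and restriction is injective on the cohomology of the cone of `G`, so an equality of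
images holds over `(X, X ∖ S)` exactly when it holds over `(V, V ∖ S)`. Neither the Dolbeault lemma
nor independence of the choice of `G` is needed. -/

theorem exists_cycle {j k : ι} (hk : c.next j = k) (x : K.X j) (hx : (K.d j k).hom x = 0) :
    ∃ z : K.cycles j, (K.iCycles j).hom z = x := by
  let T : ModuleCat.{u} R := ModuleCat.of R (LinearMap.ker (K.d j k).hom)
  let t : T ⟶ K.X j := ModuleCat.ofHom (LinearMap.ker (K.d j k).hom).subtype
  have ht : t ≫ K.d j k = 0 := by
    ext y
    exact y.2
  refine ⟨(K.liftCycles t k hk ht).hom ⟨x, hx⟩, ?_⟩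
  exact congrArg (fun f => f.hom (⟨x, hx⟩ : T)) (K.liftCycles_i t k hk ht)

theorem exists_boundary {i j : ι} (hi : c.prev j = i) (z : K.cycles j)
    (hz : (K.homologyπ j).hom z = 0) : ∃ y : K.X i, (K.iCycles j).hom z = (K.d i j).hom y := by
  -- Homology is the cokernel of the map from chains to cycles, so a cycle with trivial class lies
  -- in the image of that map.
  have hex : (ShortComplex.mk (K.toCycles i j) (K.homologyπ j) (by simp)).Exact :=
    ShortComplex.exact_of_g_is_cokernel _ (K.homologyIsCokernel i j hi)
  obtain ⟨y, hy⟩ := (ShortComplex.moduleCat_exact_iff _).1 hex z hz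
  refine ⟨y, ?_⟩
  rw [← hy]
  exact congrArg (fun f => f.hom y) (K.toCycles_i i j)

/-- A criterion for a morphism of complexes of modules to be an isomorphism in homology. -/
theorem isIso_homologyMap_of_exists (φ : K ⟶ L) (i j k : ι) (hi : c.prev j = i)
    (hk : c.next j = k)
    (hinj : ∀ x : K.X j, (K.d j k).hom x = 0 → ∀ y' : L.X i, (φ.f j).hom x = (L.d i j).hom y' →
      ∃ y : K.X i, x = (K.d i j).hom y)
    (hsurj : ∀ x' : L.X j, (L.d j k).hom x' = 0 → ∃ x : K.X j, (K.d j k).hom x = 0 ∧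
      ∃ y' : L.X i, x' = (φ.f j).hom x + (L.d i j).hom y') :
    IsIso (HomologicalComplex.homologyMap φ j) := by
  have hπ : ∀ M : HomologicalComplex (ModuleCat.{u} R) c,
      Function.Surjective (M.homologyπ j).hom := fun M =>
    (ModuleCat.epi_iff_surjective _).1 inferInstance
  have hi_inj : ∀ M : HomologicalComplex (ModuleCat.{u} R) c,
      Function.Injective (M.iCycles j).hom := fun M =>
    (ModuleCat.mono_iff_injective _).1 inferInstance
  have hd : ∀ (M : HomologicalComplex (ModuleCat.{u} R) c) (z : M.cycles j),
      (M.d j k).hom ((M.iCycles j).hom z) = 0 := fun M z =>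
    congrArg (fun f => f.hom z) (M.iCycles_d j k)
  have hb : ∀ (M : HomologicalComplex (ModuleCat.{u} R) c) (y : M.X i),
      (M.homologyπ j).hom ((M.toCycles i j).hom y) = 0 := fun M y =>
    congrArg (fun f => f.hom y) (M.toCycles_comp_homologyπ i j)
  have hit : ∀ (M : HomologicalComplex (ModuleCat.{u} R) c) (y : M.X i),
      (M.iCycles j).hom ((M.toCycles i j).hom y) = (M.d i j).hom y := fun M y =>
    congrArg (fun f => f.hom y) (M.toCycles_i i j)
  have nat : ∀ z : K.cycles j, (HomologicalComplex.homologyMap φ j).hom ((K.homologyπ j).hom z) =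
      (L.homologyπ j).hom ((HomologicalComplex.cyclesMap φ j).hom z) := fun z =>
    congrArg (fun f => f.hom z) (HomologicalComplex.homologyπ_naturality φ j)
  have nat' : ∀ z : K.cycles j, (L.iCycles j).hom ((HomologicalComplex.cyclesMap φ j).hom z) =
      (φ.f j).hom ((K.iCycles j).hom z) := fun z =>
    congrArg (fun f => f.hom z) (HomologicalComplex.cyclesMap_i φ j)
  refine (ConcreteCategory.isIso_iff_bijective _).2 ⟨?_, ?_⟩
  · refine (injective_iff_map_eq_zero (HomologicalComplex.homologyMap φ j).hom).2 fun h hh => ?_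
    obtain ⟨z, rfl⟩ := hπ K h
    rw [nat] at hh
    obtain ⟨y', hy'⟩ := exists_boundary hi _ hh
    rw [nat'] at hy'
    obtain ⟨y, hy⟩ := hinj _ (hd K z) y' hy'
    rw [hi_inj K (hy.trans (hit K y).symm), hb]
  · intro h'
    obtain ⟨z', rfl⟩ := hπ L h'
    obtain ⟨x, hx, y', hy'⟩ := hsurj _ (hd L z')
    obtain ⟨z, rfl⟩ := exists_cycle hk x hx
    refine ⟨(K.homologyπ j).hom z, (nat z).trans ?_⟩
    -- The equality is checked among chains, into which the cycles embed.
    have e : z' = (HomologicalComplex.cyclesMap φ j).hom z + (L.toCycles i j).hom y' := by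
      apply hi_inj L
      rw [map_add, nat', hit, hy']
    rw [e, map_add, hb, add_zero]

theorem homologyMap_square_apply {M N : HomologicalComplex (ModuleCat.{u} R) c} {f : K ⟶ L}
    {g : L ⟶ N} {f' : K ⟶ M} {g' : M ⟶ N} (w : f ≫ g = f' ≫ g') (j : ι) (x : K.homology j) :
    (HomologicalComplex.homologyMap g j).hom ((HomologicalComplex.homologyMap f j).hom x) =
      (HomologicalComplex.homologyMap g' j).hom
        ((HomologicalComplex.homologyMap f' j).hom x) := by
  have e := congrArg (fun F => HomologicalComplex.homologyMap F j) w
  simp only [HomologicalComplex.homologyMap_comp] at e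
  exact congrArg (fun F => F.hom x) e

end Homology

/-! ### Cartesian squares of complexes: kernels and co-mapping cones -/

section Square
variable {A B A' B' : CochainComplex (ModuleCat.{u} ℂ) ℕ} (φ : A ⟶ B) (φ' : A' ⟶ B')
  (a : A ⟶ A') (b : B ⟶ B') (w : φ ≫ b = a ≫ φ')

/-- A commutative square of complexes of modules which is cartesian in each degree induces an
isomorphism of the kernels. -/
theorem isIso_kerComplexMap
    (hinj : ∀ i (x : A.X i), (a.f i).hom x = 0 → (φ.f i).hom x = 0 → x = 0)
    (hglue : ∀ i (x' : A'.X i) (y : B.X i), (φ'.f i).hom x' = (b.f i).hom y →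
      ∃ x, (a.f i).hom x = x' ∧ (φ.f i).hom x = y) :
    IsIso (kerComplexMap φ φ' a b w) := by
  have : ∀ i, IsIso ((kerComplexMap φ φ' a b w).f i) := fun i => by
    refine (ConcreteCategory.isIso_iff_bijective _).2 ⟨?_, ?_⟩
    · refine (injective_iff_map_eq_zero ((kerComplexMap φ φ' a b w).f i).hom).2 fun x hx => ?_
      exact Subtype.ext (hinj i x.1 (congrArg Subtype.val hx) x.2)
    · intro x'
      -- Gluing with the zero element of `B` plays the role of extension by zero.
      obtain ⟨x, hx, hx0⟩ := hglue i x'.1 0 (by rw [map_zero]; exact x'.2)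
      exact ⟨⟨x, hx0⟩, Subtype.ext hx⟩
  exact HomologicalComplex.Hom.isIso_of_components _

/-- A commutative square of complexes of modules which is cartesian in each degree, and for which
the images of the two maps to the last term span it, induces an isomorphism in the cohomology of
the co-mapping cones. -/
theorem isIso_homologyMap_coConeMap
    (hinj : ∀ i (x : A.X i), (a.f i).hom x = 0 → (φ.f i).hom x = 0 → x = 0)
    (hglue : ∀ i (x' : A'.X i) (y : B.X i), (φ'.f i).hom x' = (b.f i).hom y →
      ∃ x, (a.f i).hom x = x' ∧ (φ.f i).hom x = y)
    (hspan : ∀ i (y' : B'.X i), ∃ (x' : A'.X i) (y : B.X i),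
      y' = (φ'.f i).hom x' - (b.f i).hom y) (q : ℕ) :
    IsIso (HomologicalComplex.homologyMap (coConeMap φ φ' a b w) q) := by
  have hw : ∀ (i : ℕ) (x : A.X i), (φ'.f i).hom ((a.f i).hom x) = (b.f i).hom ((φ.f i).hom x) :=
    fun i x => congrArg (fun f => (f.f i).hom x) w.symm
  have hext : ∀ i (x x₁ : A.X i), (a.f i).hom x = (a.f i).hom x₁ →
      (φ.f i).hom x = (φ.f i).hom x₁ → x = x₁ := fun i x x₁ h h' =>
    sub_eq_zero.1 (hinj i _ (by rw [map_sub, h, sub_self]) (by rw [map_sub, h', sub_self]))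
  have hnext : (ComplexShape.up ℕ).next q = q + 1 := CochainComplex.next ℕ q
  -- Surjectivity up to boundary. The hypotheses say that `(x', y')` is a cocycle of the target
  -- cone. Writing `y' = φ' s - b t` and subtracting the boundary `(d s, φ' s)` leaves `(x' - d s, b
  -- (-t))`. The second entry now comes from `B`, and `x' - d s` agrees in `B'` with `d (-t)`, so
  -- the two glue to `u`. That `d u = 0` is tested after `a` and after `φ`.
  have lift : ∀ (i : ℕ) (x' : A'.X (i + 1)) (y' : B'.X i), (A'.d (i + 1) (i + 2)).hom x' = 0 →
      (φ'.f (i + 1)).hom x' = (B'.d i (i + 1)).hom y' →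
      ∃ (u : A.X (i + 1)) (s : A'.X i) (t : B.X i), (A.d (i + 1) (i + 2)).hom u = 0 ∧
        (φ.f (i + 1)).hom u = (B.d i (i + 1)).hom t ∧
        x' = (a.f (i + 1)).hom u + (A'.d i (i + 1)).hom s ∧
        y' = (b.f i).hom t + (φ'.f i).hom s := by
    intro i x' y' h1 h2
    obtain ⟨s, t, hst⟩ := hspan i y'
    obtain ⟨u, hu, hu'⟩ := hglue (i + 1) (x' - (A'.d i (i + 1)).hom s)
      ((B.d i (i + 1)).hom (-t)) (by
        rw [map_sub, h2, hst, map_sub, map_d_apply, map_d_apply, map_neg, map_neg]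
        abel)
    refine ⟨u, s, -t, hext _ _ _ ?_ ?_, hu', ?_, ?_⟩
    · rw [map_d_apply, hu, map_sub, h1, d_d_apply, sub_zero, map_zero]
    · rw [map_d_apply, hu', d_d_apply, map_zero]
    · rw [hu, sub_add_cancel]
    · rw [hst, map_neg]
      abel
  match q with
  | 0 =>
    -- In degree `0` the predecessor index is `0` itself and `d 0 0 = 0`, so every boundary is zero
    -- and only the cartesian property enters.
    refine isIso_homologyMap_of_exists _ 0 0 1 CochainComplex.prev_nat_zero hnext ?_ ?_
    · intro x hx y' h
      refine ⟨0, ?_⟩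
      rw [HomologicalComplex.shape _ 0 0 (by simp)] at h
      rw [coCone_d] at hx
      rw [map_zero]
      exact hinj 0 x h (congrArg Prod.snd hx)
    · intro x' h
      rw [coCone_d] at h
      have h1 : (A'.d 0 1).hom x' = 0 := congrArg Prod.fst h
      have h2 : (φ'.f 0).hom x' = 0 := congrArg Prod.snd h
      obtain ⟨x, hx, hx'⟩ := hglue 0 x' 0 (by rw [h2, map_zero])
      refine ⟨x, ?_, 0, ?_⟩
      · rw [coCone_d]
        refine Prod.ext (hext _ _ _ ?_ ?_) hx'
        · change (a.f 1).hom ((A.d 0 1).hom x) = (a.f 1).hom 0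
          rw [map_d_apply, hx, h1, map_zero]
        · change (φ.f 1).hom ((A.d 0 1).hom x) = (φ.f 1).hom 0
          rw [map_d_apply, hx', map_zero, map_zero]
      · rw [map_zero, add_zero]
        exact hx.symm
  | 1 =>
    refine isIso_homologyMap_of_exists _ 0 1 2 (CochainComplex.prev_nat_succ _) hnext ?_ ?_
    · intro x hx y' h
      rw [coCone_d] at hx h
      have h1 : (a.f 1).hom x.1 = (A'.d 0 1).hom y' := congrArg Prod.fst h
      have h2 : (b.f 0).hom x.2 = (φ'.f 0).hom y' := congrArg Prod.snd h
      have hx2 : (φ.f 1).hom x.1 - (B.d 0 1).hom x.2 = 0 := congrArg Prod.snd hx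
      -- The cone in degree `0` has no `B'` entry, so the primitive `y'` needs no correction before
      -- gluing.
      obtain ⟨u, hu, hu'⟩ := hglue 0 y' x.2 h2.symm
      refine ⟨u, ?_⟩
      rw [coCone_d]
      refine Prod.ext (hext _ _ _ ?_ ?_) hu'.symm
      · change (a.f 1).hom x.1 = (a.f 1).hom ((A.d 0 1).hom u)
        rw [map_d_apply, hu, h1]
      · change (φ.f 1).hom x.1 = (φ.f 1).hom ((A.d 0 1).hom u)
        rw [map_d_apply, hu', sub_eq_zero.1 hx2]
    · intro x' h
      rw [coCone_d] at h
      obtain ⟨u, s, t, hu0, hφu, hu1, hu2⟩ := lift 0 x'.1 x'.2 (congrArg Prod.fst h)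
        (sub_eq_zero.1 (congrArg Prod.snd h))
      refine ⟨(u, t), ?_, s, ?_⟩
      · rw [coCone_d]
        exact Prod.ext hu0 (sub_eq_zero.2 hφu)
      · rw [coCone_d]
        exact Prod.ext hu1 hu2
  | q + 2 =>
    refine isIso_homologyMap_of_exists _ (q + 1) (q + 2) (q + 3) (CochainComplex.prev_nat_succ _)
      hnext ?_ ?_
    · intro x hx y' h
      rw [coCone_d] at hx h
      have h1 : (a.f (q + 2)).hom x.1 = (A'.d (q + 1) (q + 2)).hom y'.1 := congrArg Prod.fst h
      have h2 : (b.f (q + 1)).hom x.2 = (φ'.f (q + 1)).hom y'.1 - (B'.d q (q + 1)).hom y'.2 :=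
        congrArg Prod.snd h
      have hx2 : (φ.f (q + 2)).hom x.1 - (B.d (q + 1) (q + 2)).hom x.2 = 0 := congrArg Prod.snd hx
      -- The primitive `y'` is replaced by its difference with the boundary of `s`, namely `(y'.1 -
      -- d s, -b t)`. Its second entry comes from `-t`, and its first entry glues with `x.2 - d t`.
      -- The sign makes `(u, -t)` a primitive of `x`.
      obtain ⟨s, t, hst⟩ := hspan q y'.2
      obtain ⟨u, hu, hu'⟩ := hglue (q + 1) (y'.1 - (A'.d q (q + 1)).hom s)
        (x.2 - (B.d q (q + 1)).hom t) (by
          rw [map_sub, map_sub, h2, hst, map_sub, map_d_apply, map_d_apply]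
          abel)
      refine ⟨(u, -t), ?_⟩
      rw [coCone_d]
      refine Prod.ext (hext _ _ _ ?_ ?_) ?_
      · change (a.f (q + 2)).hom x.1 = (a.f (q + 2)).hom ((A.d (q + 1) (q + 2)).hom u)
        rw [map_d_apply, hu, h1, map_sub, d_d_apply, sub_zero]
      · change (φ.f (q + 2)).hom x.1 = (φ.f (q + 2)).hom ((A.d (q + 1) (q + 2)).hom u)
        rw [map_d_apply, hu', map_sub, d_d_apply, sub_zero, sub_eq_zero.1 hx2]
      · change x.2 = (φ.f (q + 1)).hom u - (B.d q (q + 1)).hom (-t)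
        rw [hu', map_neg, sub_neg_eq_add, sub_add_cancel]
    · intro x' h
      rw [coCone_d] at h
      obtain ⟨u, s, t, hu0, hφu, hu1, hu2⟩ := lift (q + 1) x'.1 x'.2 (congrArg Prod.fst h)
        (sub_eq_zero.1 (congrArg Prod.snd h))
      refine ⟨(u, t), ?_, (s, 0), ?_⟩
      · rw [coCone_d]
        exact Prod.ext hu0 (sub_eq_zero.2 hφu)
      · rw [coCone_d]
        refine Prod.ext hu1 ?_
        change x'.2 = (b.f (q + 1)).hom t + ((φ'.f (q + 1)).hom s - (B'.d q (q + 1)).hom 0)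
        rw [map_zero, sub_zero]
        exact hu2
end Square

/-! ### Two-set covers and excision for complexes of sheaves -/

section Gluing
variable {X : Type u} [TopologicalSpace X]

theorem map_map_section (F : VSheaf X) {U V W : Opens X} (h : V ≤ U) (h' : W ≤ V)
    (s : F.obj.obj (Opposite.op U)) :
    (F.obj.map (homOfLE h').op).hom ((F.obj.map (homOfLE h).op).hom s) =
      (F.obj.map (homOfLE (h'.trans h)).op).hom s :=
  (congrArg (fun f => f.hom s) (F.obj.map_comp (homOfLE h).op (homOfLE h').op)).symm

theorem section_eq_zero_of_cover (F : VSheaf X) {U V W : Opens X} (hV : V ≤ U) (hW : W ≤ U)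
    (hU : U ≤ V ⊔ W) (s : F.obj.obj (Opposite.op U))
    (h1 : (F.obj.map (homOfLE hV).op).hom s = 0) (h2 : (F.obj.map (homOfLE hW).op).hom s = 0) :
    s = 0 :=
  TopCat.Sheaf.eq_of_locally_eq₂ (X := TopCat.of X) F (homOfLE hV) (homOfLE hW) hU s 0
    (h1.trans (map_zero _).symm) (h2.trans (map_zero _).symm)

/-- The overlap is a separate variable `T`, pinned down by inequalities, so that the lemma applies
to `Q.sub`, which need not be literally an infimum. -/
theorem exists_glue_two (F : VSheaf X) {U V W T : Opens X} (hV : V ≤ U) (hW : W ≤ U)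
    (hU : U ≤ V ⊔ W) (hTV : T ≤ V) (hTW : T ≤ W) (hT : V ⊓ W ≤ T)
    (s : F.obj.obj (Opposite.op V)) (t : F.obj.obj (Opposite.op W))
    (h : (F.obj.map (homOfLE hTV).op).hom s = (F.obj.map (homOfLE hTW).op).hom t) :
    ∃ r : F.obj.obj (Opposite.op U), (F.obj.map (homOfLE hV).op).hom r = s ∧
      (F.obj.map (homOfLE hW).op).hom r = t := by
  obtain rfl : T = V ⊓ W := le_antisymm (le_inf hTV hTW) hT
  let C : Bool → Opens (TopCat.of X) := fun i => cond i V W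
  let sf : ∀ i, F.obj.obj (Opposite.op (C i)) := fun i => match i with
    | true => s
    | false => t
  have hsf : TopCat.Presheaf.IsCompatible (X := TopCat.of X) F.obj C sf := by
    rintro (_ | _) (_ | _)
    · rfl
    -- Compatibility in the opposite order: the hypothesis is transported along `V ⊓ W = W ⊓ V`.
    · have e := congrArg (F.obj.map (homOfLE (inf_comm V W).ge).op).hom h
      rw [map_map_section, map_map_section] at e
      exact e.symm
    · exact h
    · rfl
  obtain ⟨r, hr, -⟩ := TopCat.Sheaf.existsUnique_gluing' (X := TopCat.of X) F C U
    (fun i => homOfLE (match i with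
      | true => hV
      | false => hW))
    (hU.trans (sup_le (le_iSup C true) (le_iSup C false))) sf hsf
  exact ⟨r, hr true, hr false⟩

variable {P Q : OpenPair X} (h : Q ≤ P)

/-- Together with `Q ≤ P`, the two inequalities say that `P.total` is covered by `Q.total` and
`P.sub`, with overlap `Q.sub`. Sections over `Q.total` vanishing on the overlap extend by zero, so
the isomorphism holds at the level of complexes. -/
theorem isIso_kerRes (hcover : P.total ≤ Q.total ⊔ P.sub) (hinf : Q.total ⊓ P.sub ≤ Q.sub)
    (K : CochainComplex (VSheaf X) ℕ) : IsIso (OpenPair.kerRes K h) :=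
  isIso_kerComplexMap _ _ _ _ _
    (fun i x h1 h2 => section_eq_zero_of_cover (K.X i) h.1 P.le hcover x h1 h2)
    (fun i x y e => exists_glue_two (K.X i) h.1 P.le hcover Q.le h.2 hinf x y e)

/-- Excision for the co-mapping cone. -/
theorem isIso_homologyMap_coneRes (hcover : P.total ≤ Q.total ⊔ P.sub)
    (hinf : Q.total ⊓ P.sub ≤ Q.sub) (K : CochainComplex (VSheaf X) ℕ)
    (hspan : ∀ i (y : (K.X i).obj.obj (Opposite.op Q.sub)),
      ∃ (s : (K.X i).obj.obj (Opposite.op Q.total)) (t : (K.X i).obj.obj (Opposite.op P.sub)),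
        y = ((K.X i).obj.map (homOfLE Q.le).op).hom s -
          ((K.X i).obj.map (homOfLE h.2).op).hom t) (q : ℕ) :
    IsIso (HomologicalComplex.homologyMap (OpenPair.coneRes K h) q) :=
  isIso_homologyMap_coConeMap _ _ _ _ _
    (fun i x h1 h2 => section_eq_zero_of_cover (K.X i) h.1 P.le hcover x h1 h2)
    (fun i x y e => exists_glue_two (K.X i) h.1 P.le hcover Q.le h.2 hinf x y e) hspan q

/-- Flabbiness makes restriction from `Q.total` to `Q.sub` surjective, so a section over `Q.sub` is
a difference whose second term is zero. -/
theorem FlabbyResolution.isIso_homologyMap_coneRes {S : VSheaf X} (G : FlabbyResolution S)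
    (hcover : P.total ≤ Q.total ⊔ P.sub) (hinf : Q.total ⊓ P.sub ≤ Q.sub) (q : ℕ) :
    IsIso (HomologicalComplex.homologyMap (OpenPair.coneRes G.K h) q) := by
  refine RelDolbeault.isIso_homologyMap_coneRes h hcover hinf G.K (fun i y => ?_) q
  obtain ⟨s, hs⟩ := (ModuleCat.epi_iff_surjective _).1 ((G.flabby i).epi (homOfLE Q.le).op) y
  exact ⟨s, 0, by rw [map_zero, sub_zero]; exact hs.symm⟩

theorem FlabbyResolution.isIso_res {S : VSheaf X} (R : FlabbyResolution S)
    (hcover : P.total ≤ Q.total ⊔ P.sub) (hinf : Q.total ⊓ P.sub ≤ Q.sub) (q : ℕ) :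
    IsIso (R.res q h) := by
  have := isIso_kerRes h hcover hinf R.K
  exact (inferInstance : IsIso ((HomologicalComplex.homologyFunctor _ _ q).map
    (OpenPair.kerRes R.K h)))

end Gluing

/-! ### Restriction and the canonical correspondence -/

section Naturality
variable {X : Type u} [TopologicalSpace X] {P Q : OpenPair X} (h : Q ≤ P)

theorem coneMap_coneRes {K L : CochainComplex (VSheaf X) ℕ} (f : K ⟶ L) :
    P.coneMap f ≫ OpenPair.coneRes L h = OpenPair.coneRes K h ≫ Q.coneMap f := by
  ext i x
  have e : ∀ (j : ℕ) {U V : Opens X} (hVU : V ≤ U) (y : (K.X j).obj.obj (Opposite.op U)),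
      ((L.X j).obj.map (homOfLE hVU).op).hom (((f.f j).hom.app (Opposite.op U)).hom y) =
        ((f.f j).hom.app (Opposite.op V)).hom (((K.X j).obj.map (homOfLE hVU).op).hom y) :=
    fun j _ _ hVU y => (congrArg (fun g => g.hom y) ((f.f j).hom.naturality (homOfLE hVU).op)).symm
  match i with
  | 0 => exact e 0 h.1 x
  | i + 1 => exact Prod.ext (e (i + 1) h.1 x.1) (e i h.2 x.2)

theorem kerToCone_coneRes (K : CochainComplex (VSheaf X) ℕ) :
    kerToCone (sectionsRes K P.le) ≫ OpenPair.coneRes K h =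
      OpenPair.kerRes K h ≫ kerToCone (sectionsRes K Q.le) := by
  ext i x
  match i with
  | 0 => rfl
  | i + 1 => exact Prod.ext rfl (map_zero ((sectionsRes K h.2).f i).hom)

variable {E : Type} [NormedAddCommGroup E] [NormedSpace ℂ E]
  [ChartedSpace E X] [IsManifold 𝓘(ℂ, E) ω X]

/-- The witnesses `G`, `f`, `g` live on all of `X` and do not depend on the pair, so only the
equality of the two images has to be compared. -/
theorem relDolbeaultCorresponds_iff_res {p : ℕ}
    (R : FlabbyResolution (holomorphicForms E X p).sheaf) (q : ℕ)
    (hcover : P.total ≤ Q.total ⊔ P.sub) (hinf : Q.total ⊓ P.sub ≤ Q.sub)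
    (a : relDolbeaultCohomology E p q P) (b : R.cohomology q P) :
    RelDolbeaultCorresponds R a b ↔
      RelDolbeaultCorresponds R ((relDolbeaultRes E p q h).hom a) ((R.res q h).hom b) := by
  refine exists_congr fun G => exists_congr fun f => exists_congr fun g =>
    and_congr_right fun _ => and_congr_right fun _ => ?_
  have e1 := homologyMap_square_apply (coneMap_coneRes h f) q a
  have e2 := homologyMap_square_apply (coneMap_coneRes h g) q
    ((HomologicalComplex.homologyMap (kerToCone (sectionsRes R.K P.le)) q).hom b)
  rw [homologyMap_square_apply (kerToCone_coneRes h R.K) q b] at e2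
  have hG := G.isIso_homologyMap_coneRes h hcover hinf q
  have hinj := ((ConcreteCategory.isIso_iff_bijective _).1 hG).1
  -- Excision for `G` is used through its injectivity: the two images agree for `P` exactly when
  -- their restrictions to `Q` do, and `e1`, `e2` identify these restrictions with the images of the
  -- restricted classes.
  refine hinj.eq_iff.symm.trans ?_
  exact Eq.congr e1 e2

end Naturality

/-! ### Fineness of the sheaves of smooth forms -/

section Fine
variable {E : Type} [NormedAddCommGroup E] [NormedSpace ℂ E]
variable {X : Type u} [TopologicalSpace X] [ChartedSpace E X]

/-- A complex manifold is a smooth real manifold. -/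
theorem isManifold_real [IsManifold 𝓘(ℂ, E) ω X] : IsManifold 𝓘(ℝ, E) ∞ X := by
  refine isManifold_of_contDiffOn 𝓘(ℝ, E) ∞ X fun e e' he he' => ?_
  have h : ContDiffOn ℂ ω (e.symm ≫ₕ e') ((e.symm ≫ₕ e').source ∩ Set.range id) :=
    (HasGroupoid.compatible (G := contDiffGroupoid ω 𝓘(ℂ, E)) he he').1
  exact (h.restrict_scalars ℝ).of_le le_top

/-- Multiplication of a form by a function. -/
def mulForm (ρ : X → ℝ) {U : Opens X} {k : ℕ} (α : RoughForm E U k) : RoughForm E U k :=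
  fun x => ((ρ x : ℝ) : ℂ) • α x

variable [IsManifold 𝓘(ℂ, E) ω X]

theorem mulForm_mem {ρ : X → ℝ} (hρ : ContMDiff 𝓘(ℝ, E) 𝓘(ℝ, ℝ) ∞ ρ) {U : Opens X} {p q : ℕ}
    {α : RoughForm E U (p + q)} (hα : α ∈ (smoothForms E X p q).sub U) :
    mulForm ρ α ∈ (smoothForms E X p q).sub U := by
  have := isManifold_real (E := E) (X := X)
  refine ⟨fun x c v => ?_, fun x₀ => ?_⟩
  · change (ρ x : ℂ) * α x _ = _ * ((ρ x : ℂ) * α x v)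
    rw [hα.1, mul_left_comm]
  · have hs : ContDiffOn ℝ ∞ (fun y => ρ ((extChartAt 𝓘(ℂ, E) x₀).symm y))
        (chartDom E x₀ U) := by
      have h1 : ContMDiffOn 𝓘(ℝ, E) 𝓘(ℝ, ℝ) ∞ (ρ ∘ (extChartAt 𝓘(ℝ, E) x₀).symm)
          (extChartAt 𝓘(ℝ, E) x₀).target :=
        hρ.comp_contMDiffOn (contMDiffOn_extChartAt_symm x₀)
      -- The extended charts for the real and for the complex model coincide definitionally, so
      -- smoothness in real charts applies on `chartDom`.
      exact h1.contDiffOn.mono fun y hy => hy.1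
    refine (ContDiffOn.smul hs (hα.2 x₀)).congr fun y hy => ?_
    ext v
    change chartRep x₀ (mulForm ρ α) y v =
      ((ρ ((extChartAt 𝓘(ℂ, E) x₀).symm y) : ℝ) : ℂ) * chartRep x₀ α y v
    simp only [chartRep, extZero_of_mem _ hy.2, mulForm]
    rfl

/-- A form on `V ⊓ W` multiplied by a smooth function vanishing near `V ∖ W` extends to `V`. -/
theorem exists_extend_mulForm {ρ : X → ℝ} (hρ : ContMDiff 𝓘(ℝ, E) 𝓘(ℝ, ℝ) ∞ ρ) {T V W : Opens X}
    (hTV : T ≤ V) (hT : V ⊓ W ≤ T) (h0 : ∀ x ∈ V, x ∉ W → ρ =ᶠ[𝓝 x] 0) {p q : ℕ}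
    {α : RoughForm E T (p + q)} (hα : α ∈ (smoothForms E X p q).sub T) :
    ∃ β ∈ (smoothForms E X p q).sub V, restr hTV β = mulForm ρ α := by
  refine ⟨fun x => extZero (mulForm ρ α) (x : X), (smoothForms E X p q).local_mem fun x hx => ?_,
    funext fun x => extZero_of_mem _ x.2⟩
  -- Membership is local. Near a point of `W` the extension is the product on `T`; near any other
  -- point of `V` the function `ρ`, and hence the extension, vanishes identically.
  by_cases hxW : x ∈ W
  · refine ⟨T, hTV, hT ⟨hx, hxW⟩, ?_⟩
    convert mulForm_mem hρ hα using 1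
    exact funext fun x => extZero_of_mem _ x.2
  · obtain ⟨N, hN, hNo, hxN⟩ := eventually_nhds_iff.1 (h0 x hx hxW)
    refine ⟨V ⊓ ⟨N, hNo⟩, inf_le_left, ⟨hx, hxN⟩, ?_⟩
    convert ((smoothForms E X p q).sub (V ⊓ ⟨N, hNo⟩)).zero_mem using 1
    funext y
    have hy : ρ y = 0 := hN y y.2.2
    change extZero (mulForm ρ α) (y : X) = 0
    unfold extZero
    split_ifs with h
    · change ((ρ y : ℝ) : ℂ) • α ⟨y, h⟩ = 0
      rw [hy]
      ext v
      exact zero_mul _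
    · rfl

/-- The sheaf of smooth forms of type `(p, q)` is fine. -/
theorem smoothForms_exists_sub [FiniteDimensional ℂ E] [T2Space X] [SecondCountableTopology X]
    {T V W : Opens X} (hTV : T ≤ V) (hTW : T ≤ W) (hT : V ⊓ W ≤ T) (hVW : V ⊔ W = ⊤) {p q : ℕ}
    (α : (smoothForms E X p q).sub T) :
    ∃ (β : (smoothForms E X p q).sub V) (γ : (smoothForms E X p q).sub W),
      α = (smoothForms E X p q).restrLin hTV β - (smoothForms E X p q).restrLin hTW γ := by
  have := isManifold_real (E := E) (X := X)
  -- Finite dimension makes `X` locally compact; with the Hausdorff property and a countable basis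
  -- this supplies smooth functions separating closed sets.
  have : FiniteDimensional ℝ E := FiniteDimensional.complexToReal E
  have : ProperSpace E := FiniteDimensional.proper_real E
  have : LocallyCompactSpace X := ChartedSpace.locallyCompactSpace E X
  have hd : Disjoint (V : Set X)ᶜ (W : Set X)ᶜ := by
    rw [Set.disjoint_compl_left_iff_subset]
    intro x hx
    have hx' : x ∈ V ⊔ W := hVW ▸ Opens.mem_top x
    exact (Opens.mem_sup.1 hx').resolve_right hx
  -- `ρ` is `0` near the complement of `V` and `1` near the complement of `W`. Hence `(1 - ρ) α`
  -- extends by zero to `V` and `-ρ α` to `W`, and their difference is `α`. Constancy on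
  -- neighbourhoods, not just on the closed sets, keeps the extensions smooth.
  obtain ⟨ρ, h0, h1, -⟩ := exists_contMDiffMap_zero_one_nhds_of_isClosed 𝓘(ℝ, E) (n := ⊤)
    V.isOpen.isClosed_compl W.isOpen.isClosed_compl hd
  rw [eventually_nhdsSet_iff_forall] at h0 h1
  obtain ⟨β, hβ, eβ⟩ := exists_extend_mulForm (ρ := fun x => 1 - ρ x)
    (contMDiff_const.sub ρ.contMDiff) hTV hT
    (fun x _ hx => (h1 x hx).mono fun y hy => by simp [hy]) α.2
  obtain ⟨γ, hγ, eγ⟩ := exists_extend_mulForm (ρ := fun x => - ρ x)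
    ρ.contMDiff.neg hTW (inf_comm V W ▸ hT)
    (fun x _ hx => (h0 x hx).mono fun y hy => by simp [hy]) α.2
  refine ⟨⟨β, hβ⟩, ⟨γ, hγ⟩, Subtype.ext ?_⟩
  change α.1 = restr hTV β - restr hTW γ
  rw [eβ, eγ]
  funext x
  ext v
  change α.1 x v = ((1 - ρ x : ℝ) : ℂ) * α.1 x v - ((- ρ x : ℝ) : ℂ) * α.1 x v
  push_cast
  ring

end Fine

/-! ### Excision for relative Dolbeault cohomology and the final statement -/

/-- The cover is required to be of all of `X` because the cutoff function is constructed on `X`,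
from the disjoint closed complements of `Q.total` and `P.sub`. -/
theorem isIso_relDolbeaultRes {E : Type} [NormedAddCommGroup E] [NormedSpace ℂ E]
    [FiniteDimensional ℂ E] {X : Type u} [TopologicalSpace X] [T2Space X]
    [SecondCountableTopology X] [ChartedSpace E X] [IsManifold 𝓘(ℂ, E) ω X] (p q : ℕ)
    {P Q : OpenPair X} (h : Q ≤ P) (hcover : Q.total ⊔ P.sub = ⊤)
    (hinf : Q.total ⊓ P.sub ≤ Q.sub) : IsIso (relDolbeaultRes E p q h) :=
  isIso_homologyMap_coneRes h (le_top.trans hcover.ge) hinf _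
    (fun _ α => smoothForms_exists_sub Q.le h.2 hinf hcover α) q

end RelDolbeault
end

theorem proposition4p5 {E : Type} [NormedAddCommGroup E] [NormedSpace ℂ E] [FiniteDimensional ℂ E]
    {X : Type*} [TopologicalSpace X] [T2Space X] [SecondCountableTopology X]
    [ChartedSpace E X] [IsManifold 𝓘(ℂ, E) ω X] (p q : ℕ)
    (S : Set X) (hS : IsClosed S) (V : Opens X) (hSV : S ⊆ (V : Set X)) :
    IsIso (relDolbeaultRes E p q (complPair_le (le_top : V ≤ ⊤) hS)) ∧
    ∀ R : FlabbyResolution (holomorphicForms E X p).sheaf,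
      IsIso (R.res q (complPair_le (le_top : V ≤ ⊤) hS)) ∧
      ∀ (a : relDolbeaultCohomology E p q (complPair ⊤ hS)) (b : R.cohomology q (complPair ⊤ hS)),
        RelDolbeaultCorresponds R a b ↔
          RelDolbeaultCorresponds R
            ((relDolbeaultRes E p q (complPair_le (le_top : V ≤ ⊤) hS)).hom a)
            ((R.res q (complPair_le (le_top : V ≤ ⊤) hS)).hom b) := by
  -- This is where `S ⊆ V` enters: points of `S` lie in `V`, all others in `X ∖ S`.
  have hcover : (complPair V hS).total ⊔ (complPair ⊤ hS).sub = ⊤ := by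
    refine top_le_iff.1 fun x _ => Opens.mem_sup.2 ?_
    by_cases hx : x ∈ S
    · exact Or.inl (hSV hx)
    · exact Or.inr ⟨trivial, hx⟩
  have hinf : (complPair V hS).total ⊓ (complPair ⊤ hS).sub ≤ (complPair V hS).sub :=
    fun x hx => ⟨hx.1, hx.2.2⟩
  have hle : (complPair ⊤ hS).total ≤ (complPair V hS).total ⊔ (complPair ⊤ hS).sub :=
    le_top.trans hcover.ge
  exact ⟨isIso_relDolbeaultRes p q _ hcover hinf, fun R => ⟨R.isIso_res _ hle hinf q,
    relDolbeaultCorresponds_iff_res _ R q hle hinf⟩⟩
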